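/- Let $\Gamma$ be a connected graph with path metric $d_\Gamma$ that is Gromov hyperbolic, and let $\mathcal H$ be a family of connected subgraphs of $\Gamma$, each of infinite diameter, which are uniformly quasi-isometrically embedded: there is $K\ge 1$ such that for every $H\in\mathcal H$ the inclusion $(H,d_H)\to(\Gamma,d_\Gamma)$, where $d_H$ is the path metric of $H$, is a $(K,K)$-quasi-isometric embedding. Suppose that for every $\epsilon$ there is $R=R(\epsilon)$ such that for all distinct $H_1,H_2\in\mathcal H$ the set $N_\epsilon(H_1)\cap H_2$ has diameter at most $R$. Then $\mathcal H$ is a factor system for $\Gamma$. That is, with $p_A$ denoting the (set-valued) closest point projection to $A$ in $\Gamma$, there are constants $K\ge 1$, $\xi,B\ge 0$ and $c\in\mathbb N$ such that: (1) each $H\in\mathcal H$ is $(K,K)$-quasi-isometrically embedded in $\Gamma$; (2) for $H_1,H_2\in\mathcal H$, either $\operatorname{diam}(p_{H_1}(H_2))\le\xi$, or there is $U\in\mathcal H$ with $U\subseteq H_1$ and $d_{\mathrm{Haus}}(p_{H_1}(H_2),U)\le B$; (3) for $H_1,H_2\in\mathcal H$, if $d_{\mathrm{Haus}}(p_{H_1}(H_2),H_1)\le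 B$ then $H_1\subseteq H_2$; (4) every chain $H_1\subsetneq\dots\subsetneq H_n$ in $\mathcal H$ has $n\le c$; (5) for $H_1,H_2\in\mathcal H$, if $d_{\mathrm{Haus}}(H_1,H_2)<\infty$ then $H_1=H_2$. Moreover, $(\Gamma,\mathcal H\cup\{\Gamma\})$ is a hierarchically hyperbolic space in the sense of Behrstock--Hagen--Sisto: $\Gamma$ admits a hierarchically hyperbolic structure with index set $\mathcal H\cup\{\Gamma\}$, in which nesting is inclusion and no two elements are orthogonal, the hyperbolic space associated with $W\in\mathcal H\cup\{\Gamma\}$ is the cone-off $\widehat W$ of $W$ (the graph obtained from $W$ by joining by an edge any two distinct vertices lying in a common $H\in\mathcal H$ with $H\subsetneq W$), and the projection $\pi_W$ sends a point $x$ of $\Gamma$ to the set of points of $W$ closest to $x$ in $\Gamma$. Here graphs are regarded as metric spaces through their vertex sets with the path metric. -/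

import Mathlib

universe u v w

namespace HHGraph

/-! Coarse geometry of metric spaces -/

section Metric

variable {M : Type u} [MetricSpace M] {N : Type v} [MetricSpace N]

/-- The set `S` has diameter at most `R`. -/
def DiamLE (S : Set M) (R : ℝ) : Prop := ∀ x ∈ S, ∀ y ∈ S, dist x y ≤ R

/-- The distance `inf {d(a, b) | a ∈ A, b ∈ B}` between two (nonempty) sets. -/
noncomputable def setDist (A B : Set M) : ℝ := sInf (Set.image2 dist A B)

/-- The closed `ε`-neighbourhood `{x | d(x, a) ≤ ε for some a ∈ A}`. -/
def nbhd (ε : ℝ) (A : Set M) : Set M := {x | ∃ a ∈ A, dist x a ≤ ε}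

/-- The closest point projection of `x` to `A`, as a set: all points of `A` nearest to `x`. -/
def closestPts (A : Set M) (x : M) : Set M := {a | a ∈ A ∧ ∀ b ∈ A, dist x a ≤ dist x b}

/-- The closest point projection `p_A(B)` of a set `B` to `A`. -/
def projSet (A B : Set M) : Set M := ⋃ x ∈ B, closestPts A x

/-- `f` is a `(K, K)`-quasi-isometric embedding. -/
def IsQIEmbedding (K : ℝ) (f : M → N) : Prop :=
  ∀ x y, dist x y / K - K ≤ dist (f x) (f y) ∧ dist (f x) (f y) ≤ K * dist x y + K

/-- `γ` is (the image of) a geodesic from `x` to `y`: the image of an isometric embedding of a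
real interval `[0, L]` or of an integer interval `{0, …, n}`. The first kind is the notion for
length spaces, the second the one for a graph regarded as its set of vertices. -/
def IsGeodesic (γ : Set M) (x y : M) : Prop :=
  (∃ (L : ℝ) (f : ℝ → M), 0 ≤ L ∧ f 0 = x ∧ f L = y ∧
      (∀ s ∈ Set.Icc 0 L, ∀ t ∈ Set.Icc 0 L, dist (f s) (f t) = |s - t|) ∧
      γ = f '' Set.Icc 0 L) ∨
  (∃ (n : ℕ) (f : ℕ → M), f 0 = x ∧ f n = y ∧
      (∀ s ∈ Set.Icc 0 n, ∀ t ∈ Set.Icc 0 n, dist (f s) (f t) = |(s : ℝ) - (t : ℝ)|) ∧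
      γ = f '' Set.Icc 0 n)

/-- `M` is `q`-quasigeodesic: any two points are joined by a `(q, q)`-quasigeodesic. -/
def IsQuasigeodesicSpace (q : ℝ) (M : Type u) [MetricSpace M] : Prop :=
  1 ≤ q ∧ ∀ x y : M, ∃ (L : ℝ) (f : ℝ → M), 0 ≤ L ∧ f 0 = x ∧ f L = y ∧
    ∀ s ∈ Set.Icc 0 L, ∀ t ∈ Set.Icc 0 L,
      |s - t| / q - q ≤ dist (f s) (f t) ∧ dist (f s) (f t) ≤ q * |s - t| + q

/-- `M` is a `δ`-hyperbolic space: any two points are joined by a geodesic and all geodesic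
triangles are `δ`-slim. -/
structure IsHyperbolicSpace (δ : ℝ) (M : Type u) [MetricSpace M] : Prop where
  exists_geodesic : ∀ x y : M, ∃ γ, IsGeodesic γ x y
  slim : ∀ (x y z : M) (α β γ : Set M), IsGeodesic α x y → IsGeodesic β y z →
    IsGeodesic γ x z → ∀ p ∈ α, ∃ q ∈ β ∪ γ, dist p q ≤ δ

end Metric

/-! Hierarchically hyperbolic spaces -/

/-- A hierarchically hyperbolic structure on the space `X`, with index set `𝔖` and associated
spaces `C W`. -/
structure HHStructure (X : Type u) [MetricSpace X] (𝔖 : Type v) (C : 𝔖 → Type w)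
    [∀ W, MetricSpace (C W)] where
  /-- `V` is nested in `W`. -/
  nest : 𝔖 → 𝔖 → Prop
  /-- `V` and `W` are orthogonal. -/
  orth : 𝔖 → 𝔖 → Prop
  /-- The projections `π_W`. -/
  proj : ∀ W, X → Set (C W)
  /-- The set `ρ^V_W ⊆ C W`, used when `V` is properly nested in or transverse to `W`. -/
  rhoSet : 𝔖 → ∀ W : 𝔖, Set (C W)
  /-- The map `ρ^W_V : C W → 2^(C V)`, used when `V` is properly nested in `W`. -/
  rhoMap : ∀ W V : 𝔖, C W → Set (C V)
  (q δ ξ K κ₀ lam E α : ℝ)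
  complexity : ℕ
  θ : ℝ → ℝ
  quasigeodesic : IsQuasigeodesicSpace q X
  δ_nonneg : 0 ≤ δ
  hyperbolic : ∀ W, IsHyperbolicSpace δ (C W)
  -- projections
  ξ_nonneg : 0 ≤ ξ
  proj_nonempty : ∀ W x, (proj W x).Nonempty
  proj_diam : ∀ W x, DiamLE (proj W x) ξ
  proj_lipschitz : ∀ W x y, setDist (proj W x) (proj W y) ≤ K * dist x y + K
  -- nesting
  nest_refl : ∀ W, nest W W
  nest_trans : ∀ U V W, nest U V → nest V W → nest U W
  nest_antisymm : ∀ V W, nest V W → nest W V → V = W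
  nest_max : IsEmpty 𝔖 ∨ ∃! S, ∀ W, nest S W → W = S
  rhoSet_nest : ∀ V W, nest V W → V ≠ W →
    (rhoSet V W).Nonempty ∧ DiamLE (rhoSet V W) ξ
  rhoMap_nonempty : ∀ V W, nest V W → V ≠ W → ∀ p, (rhoMap W V p).Nonempty
  -- orthogonality
  orth_symm : ∀ V W, orth V W → orth W V
  orth_irrefl : ∀ V, ¬ orth V V
  orth_of_nest : ∀ U V W, nest V W → orth W U → orth V U
  orth_container : ∀ T U, nest U T → (∃ V, nest V T ∧ orth V U) →
    ∃ W, nest W T ∧ W ≠ T ∧ ∀ V, orth V U → nest V T → nest V W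
  orth_not_nest : ∀ V W, orth V W → ¬ nest V W ∧ ¬ nest W V
  -- transversality and consistency
  κ₀_nonneg : 0 ≤ κ₀
  rhoSet_transverse : ∀ V W, ¬ orth V W → ¬ nest V W → ¬ nest W V →
    (rhoSet V W).Nonempty ∧ DiamLE (rhoSet V W) ξ
  consistency_transverse : ∀ V W, ¬ orth V W → ¬ nest V W → ¬ nest W V → ∀ x,
    min (setDist (proj W x) (rhoSet V W)) (setDist (proj V x) (rhoSet W V)) ≤ κ₀
  consistency_nest : ∀ V W, nest V W → V ≠ W → ∀ x,
    setDist (proj W x) (rhoSet V W) ≤ κ₀ ∨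
      DiamLE (proj V x ∪ ⋃ p ∈ proj W x, rhoMap W V p) κ₀
  rho_consistency : ∀ U V W, nest U V →
    ((nest V W ∧ V ≠ W) ∨ ((¬ orth V W ∧ ¬ nest V W ∧ ¬ nest W V) ∧ ¬ orth W U)) →
    setDist (rhoSet U W) (rhoSet V W) ≤ κ₀
  -- finite complexity
  finite_complexity : ∀ s : Set 𝔖, (∀ V ∈ s, ∀ W ∈ s, nest V W ∨ nest W V) →
    s.encard ≤ complexity
  -- large links
  one_le_lam : 1 ≤ lam
  max_le_E : max ξ κ₀ ≤ E
  large_links : ∀ W x x', ∃ T : Finset 𝔖,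
    T.card ≤ ⌊lam * setDist (proj W x) (proj W x') + lam⌋₊ ∧
    (∀ U ∈ T, nest U W ∧ U ≠ W ∧
      setDist (proj W x) (rhoSet U W) ≤ lam * setDist (proj W x) (proj W x') + lam) ∧
    ∀ V, nest V W → V ≠ W →
      (∃ U ∈ T, nest V U) ∨ setDist (proj V x) (proj V x') < E
  -- bounded geodesic image
  bounded_geodesic_image : ∀ V W, nest V W → V ≠ W → ∀ (a b : C W) (γ : Set (C W)),
    IsGeodesic γ a b →
      DiamLE (⋃ p ∈ γ, rhoMap W V p) E ∨ (γ ∩ nbhd E (rhoSet V W)).Nonempty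
  -- partial realization
  partial_realization : ∀ (s : Set 𝔖) (p : ∀ V, C V), s.Pairwise orth →
    (∀ V ∈ s, ∃ x, p V ∈ proj V x) →
    ∃ x, ∀ V ∈ s, setDist (proj V x) {p V} ≤ α ∧
      (∀ W, nest V W → V ≠ W → setDist (proj W x) (rhoSet V W) ≤ α) ∧
      (∀ W, ¬ orth V W → ¬ nest V W → ¬ nest W V → setDist (proj W x) (rhoSet V W) ≤ α)
  -- uniqueness
  uniqueness : ∀ κ, 0 ≤ κ → ∀ x y, θ κ ≤ dist x y →
    ∃ V, κ ≤ setDist (proj V x) (proj V y)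

/-! Graphs, factor systems and cone-offs -/

section Graph

variable {V : Type u}

/-- A connected graph, regarded as a metric space: its set of vertices with the path metric. -/
def VertexSpace (G : SimpleGraph V) (_ : G.Connected) : Type u := V

noncomputable instance (G : SimpleGraph V) (hG : G.Connected) :
    MetricSpace (VertexSpace G hG) where
  dist x y := (SimpleGraph.dist (V := V) G x y : ℝ)
  dist_self x := by
    exact_mod_cast SimpleGraph.dist_self (G := G) (v := (show V from x))
  dist_comm x y := by
    exact_mod_cast SimpleGraph.dist_comm (G := G) (u := (show V from x)) (v := (show V from y))
  dist_triangle x y z := by exact_mod_cast hG.dist_triangle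
  eq_of_dist_eq_zero {x y} h := by
    have h' : SimpleGraph.dist (V := V) G x y = 0 := by exact_mod_cast h
    exact hG.dist_eq_zero_iff.1 h'

variable (Γ : SimpleGraph V) (hΓ : Γ.Connected)

/-- A subgraph as a subset of the ambient metric graph. -/
def pts (H : Γ.Subgraph) : Set (VertexSpace Γ hΓ) := H.verts

/-- The inclusion of a connected subgraph, with its own path metric, into the ambient graph. -/
def incl (H : Γ.Subgraph) (hH : H.Connected) : VertexSpace H.coe hH.coe → VertexSpace Γ hΓ :=
  fun x => (show H.verts from x).1

/-- `ℋ` is a factor system for the connected graph `Γ`. -/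
def IsFactorSystem (ℋ : Set Γ.Subgraph) : Prop :=
  ∃ hconn : ∀ H ∈ ℋ, H.Connected, ∃ (K ξ B : ℝ) (c : ℕ), 1 ≤ K ∧ 0 ≤ ξ ∧ 0 ≤ B ∧
    (∀ H (hH : H ∈ ℋ), IsQIEmbedding K (incl Γ hΓ H (hconn H hH))) ∧
    (∀ H₁ ∈ ℋ, ∀ H₂ ∈ ℋ, DiamLE (projSet (pts Γ hΓ H₁) (pts Γ hΓ H₂)) ξ ∨
      ∃ U ∈ ℋ, U ≤ H₁ ∧
        Metric.hausdorffEDist (projSet (pts Γ hΓ H₁) (pts Γ hΓ H₂)) (pts Γ hΓ U)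
          ≤ ENNReal.ofReal B) ∧
    (∀ H₁ ∈ ℋ, ∀ H₂ ∈ ℋ,
      Metric.hausdorffEDist (projSet (pts Γ hΓ H₁) (pts Γ hΓ H₂)) (pts Γ hΓ H₁)
        ≤ ENNReal.ofReal B → H₁ ≤ H₂) ∧
    (∀ (n : ℕ) (f : Fin n → Γ.Subgraph), (∀ i, f i ∈ ℋ) → StrictMono f → n ≤ c) ∧
    (∀ H₁ ∈ ℋ, ∀ H₂ ∈ ℋ,
      Metric.hausdorffEDist (pts Γ hΓ H₁) (pts Γ hΓ H₂) < ⊤ → H₁ = H₂)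

variable {Γ}

/-- The cone-off of the subgraph `W` with respect to all elements of `ℋ` strictly contained in
`W`: each pair of distinct vertices of such an element is joined by an edge. -/
def coneOff (ℋ : Set Γ.Subgraph) (W : Γ.Subgraph) : SimpleGraph W.verts :=
  W.coe ⊔ SimpleGraph.fromRel (fun x y => ∃ H ∈ ℋ, H < W ∧ x.1 ∈ H.verts ∧ y.1 ∈ H.verts)

theorem coneOff_connected (ℋ : Set Γ.Subgraph) (W : Γ.Subgraph) (hW : W.Connected) :
    (coneOff ℋ W).Connected :=
  hW.coe.mono le_sup_left

theorem connected_insert_top (hΓ : Γ.Connected) (ℋ : Set Γ.Subgraph)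
    (hconn : ∀ H ∈ ℋ, H.Connected) (W : ↥(insert ⊤ ℋ : Set Γ.Subgraph)) :
    W.1.Connected := by
  obtain ⟨W, rfl | hW⟩ := W
  · exact ⟨(SimpleGraph.Subgraph.topIso.connected_iff).2 hΓ⟩
  · exact hconn W hW

/-- The metric cone-offs associated with the elements of `ℋ ∪ {Γ}`. -/
abbrev ConeOffSpace (hΓ : Γ.Connected) (ℋ : Set Γ.Subgraph) (hconn : ∀ H ∈ ℋ, H.Connected)
    (W : ↥(insert ⊤ ℋ : Set Γ.Subgraph)) : Type u :=
  VertexSpace (coneOff ℋ W.1)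
    (coneOff_connected ℋ W.1 (connected_insert_top hΓ ℋ hconn W))

/-- The closest point projection of a vertex `x` of `Γ` to `W`, taken in the metric of `Γ` and
regarded as a set of points of the cone-off of `W`. -/
def coneOffProj (hΓ : Γ.Connected) (ℋ : Set Γ.Subgraph) (hconn : ∀ H ∈ ℋ, H.Connected)
    (W : ↥(insert ⊤ ℋ : Set Γ.Subgraph)) (x : VertexSpace Γ hΓ) :
    Set (ConeOffSpace hΓ ℋ hconn W) :=
  {a | (show W.1.verts from a).1 ∈ closestPts (pts Γ hΓ W.1) x}

end Graph

end HHGraph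

namespace HHGraph

/-! Chains and stability of quasigeodesics -/

section Stability

/-! Separation at scale `0` together with infinite diameter makes `ℋ` an antichain. So nesting on `ℋ
∪ {Γ}` has at most two levels: a member other than `Γ` is its own cone-off, only `Γ` is really
coned, and the nesting axioms concern pairs `H ⊂ Γ` only. Orthogonality is empty.

Hyperbolicity comes from one stability principle, `exists_stability`: a quasigeodesic chain stays
close to any family of connected sets `L x y` with slim triangles. With `L` the geodesic intervals
of `Γ`, applied to geodesics of the members, it gives uniform quasiconvexity and hyperbolicity of
the members (`exists_quasiConvex_hyperbolic`). With the same intervals viewed inside the cone-off of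
`Γ`, it gives hyperbolicity of the cone-off and shows that its geodesics pass close to the intervals
of `Γ` (`exists_cone_stability`).

Projections are handled through the four point condition. Quasiconvexity makes closest point
projection efficient (`QuasiConvex.efficientProj`): passing through the projection costs a bounded
detour. If two points project far apart, the path through both projections is then almost geodesic
(`EfficientProj.contracting`). This yields the transversal consistency inequality, the bounded
geodesic image property, and, with the separation hypothesis, bounded projections between distinct
members.

Large links and uniqueness are counting arguments along a cone-off geodesic from `x` to `x'`. The
function `coord` (twice a Gromov product) records positions between `x` and `x'`. A member with
distant projections of `x` and `x'` follows a long range of positions, and by separation distinct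
members have almost disjoint ranges, so each step of the geodesic crosses the midpoint of at most
one range (`eq_of_crossing`). Conversely, if the cone-off distance is small but `d(x, x')` is large,
some step covers a long range; it is not an edge of `Γ`, so it lies in a member, and that member
separates the projections (`exists_far_projections`). -/

theorem exists_step_of_not {Q : ℕ → Prop} {n : ℕ} (h0 : Q 0) (hn : ¬ Q n) :
    ∃ i < n, Q i ∧ ¬ Q (i + 1) := by
  by_contra! hcon
  have : ∀ i ≤ n, Q i := by
    intro i
    induction i with
    | zero => exact fun _ => h0
    | succ i ih => exact fun hi => hcon i (by omega) (ih (by omega))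
  exact hn (this n le_rfl)

variable {X : Type u} [MetricSpace X]

theorem dist_le_of_chain {f : ℕ → X} {n : ℕ} (hf : ∀ i < n, dist (f i) (f (i + 1)) ≤ 1)
    {i j : ℕ} (hij : i ≤ j) (hj : j ≤ n) : dist (f i) (f j) ≤ (j : ℝ) - i := by
  induction j, hij using Nat.le_induction with
  | base => simp
  | succ j hij ih =>
    have h1 := ih (by omega)
    have h2 := hf j (by omega)
    have h3 := dist_triangle (f i) (f j) (f (j + 1))
    push_cast
    linarith

theorem dist_eq_of_chain {f : ℕ → X} {n : ℕ} (hf : ∀ i < n, dist (f i) (f (i + 1)) ≤ 1)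
    (hn : dist (f 0) (f n) = n) {s t : ℕ} (hs : s ≤ n) (ht : t ≤ n) :
    dist (f s) (f t) = |(s : ℝ) - t| := by
  wlog hst : s ≤ t generalizing s t
  · rw [dist_comm, abs_sub_comm]
    exact this ht hs (by omega)
  have h1 := dist_le_of_chain hf hst ht
  have h2 := dist_le_of_chain hf (Nat.zero_le s) hs
  have h3 := dist_le_of_chain hf ht le_rfl
  have h4 := dist_triangle4 (f 0) (f s) (f t) (f n)
  have h5 : (s : ℝ) ≤ t := by exact_mod_cast hst
  rw [abs_sub_comm, abs_of_nonneg (by linarith)]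
  push_cast at h2
  linarith

/-- Bisect the parameter interval: each halving costs one application of slimness. The chain need
not be quasigeodesic, and the bound is logarithmic in its length. -/
theorem exists_dist_le_log {L : X → X → Set X} {h : ℝ}
    (hL : ∀ x y z, ∀ w ∈ L x y, ∃ v ∈ L x z ∪ L z y, dist w v ≤ h)
    (hL1 : ∀ x y, dist x y ≤ 1 → ∀ w ∈ L x y, dist w x ≤ h)
    {f : ℕ → X} {n : ℕ} (hf : ∀ i < n, dist (f i) (f (i + 1)) ≤ 1) (k : ℕ) :
    ∀ a b, a ≤ b → b ≤ n → b ≤ a + 2 ^ k → ∀ w ∈ L (f a) (f b),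
      ∃ t, a ≤ t ∧ t ≤ b ∧ dist w (f t) ≤ h * (k + 1) := by
  induction k with
  | zero =>
    intro a b hab hb hk w hw
    refine ⟨a, le_rfl, hab, ?_⟩
    have h1 := dist_le_of_chain hf hab hb
    have h2 : (b : ℝ) ≤ a + 1 := by exact_mod_cast hk
    simpa using hL1 _ _ (by linarith) w hw
  | succ k ih =>
    intro a b hab hb hk w hw
    rw [pow_succ] at hk
    obtain ⟨v, hv | hv, hwv⟩ := hL _ _ (f (min b (a + 2 ^ k))) w hw
    · obtain ⟨t, h1, h2, h3⟩ := ih a _ (by omega) (by omega) (by omega) v hv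
      refine ⟨t, h1, by omega, (dist_triangle w v _).trans ?_⟩
      push_cast
      linarith
    · obtain ⟨t, h1, h2, h3⟩ := ih _ b (by omega) (by omega) (by omega) v hv
      refine ⟨t, by omega, by omega, (dist_triangle w v _).trans ?_⟩
      push_cast
      linarith

/-- Bootstrap: an a priori bound `s` localises the problem to a subchain of length about `2 * T`,
with `T` linear in `s`, where the logarithmic estimate applies. The new bound is thus logarithmic in
`s`. -/
theorem exists_dist_le_improve {L : X → X → Set X} {h : ℝ} (h0 : 0 ≤ h)
    (hL : ∀ x y z, ∀ w ∈ L x y, ∃ v ∈ L x z ∪ L z y, dist w v ≤ h)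
    (hL1 : ∀ x y, dist x y ≤ 1 → ∀ w ∈ L x y, dist w x ≤ h)
    {K s : ℝ} (hK : 0 ≤ K) {T k : ℕ} (hT : K * (2 * s + 2 * h) + K < T) (hk : 2 * T ≤ 2 ^ k)
    {f : ℕ → X} {n : ℕ} (hf : ∀ i < n, dist (f i) (f (i + 1)) ≤ 1)
    (hq : ∀ i j, i ≤ j → j ≤ n → (j : ℝ) - i ≤ K * dist (f i) (f j) + K)
    (hP : ∀ a b, a ≤ b → b ≤ n → ∀ w ∈ L (f a) (f b), ∃ t, a ≤ t ∧ t ≤ b ∧ dist w (f t) ≤ s) :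
    ∀ a b, a ≤ b → b ≤ n → ∀ w ∈ L (f a) (f b),
      ∃ t, a ≤ t ∧ t ≤ b ∧ dist w (f t) ≤ 3 * h + h * (k + 1) := by
  intro a b hab hb w hw
  have hhk : 0 ≤ h * (k + 1) := by positivity
  obtain ⟨t, hat, htb, hwt⟩ := hP a b hab hb w hw
  -- Cut at parameters `t - T` and `t + T`, truncated to `[a, b]`. If slimness leads to an outer
  -- piece, the a priori bound gives a chain point near `w` whose parameter differs from `t` by at
  -- least `T`, contradicting `hq` and the choice of `T`; a truncated outer piece is degenerate and
  -- lies near an end point.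
  obtain ⟨v, hv | hv, hwv⟩ := hL _ _ (f (max a (t - T))) w hw
  · rcases Nat.lt_or_ge a (t - T) with hlt | hge
    · obtain ⟨r, h1, h2, h3⟩ := hP a _ (by omega) (by omega) v hv
      exfalso
      have h4 : dist (f r) (f t) ≤ 2 * s + 2 * h := by
        have := dist_triangle4 (f r) v w (f t)
        rw [dist_comm (f r) v, dist_comm v w] at this
        linarith
      have h5 := hq r t (by omega) (by omega)
      have h6 : (r : ℝ) + T ≤ t := by exact_mod_cast (by omega : r + T ≤ t)
      have := mul_le_mul_of_nonneg_left h4 hK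
      linarith
    · rw [max_eq_left hge] at hv
      have := hL1 _ _ (by simp) v hv
      exact ⟨a, le_rfl, hab, by linarith [dist_triangle w v (f a)]⟩
  · obtain ⟨v', hv' | hv', hvv⟩ := hL _ _ (f (min b (t + T))) v hv
    · obtain ⟨r, h1, h2, h3⟩ := exists_dist_le_log hL hL1 hf k _ _ (by omega) (by omega)
        (by omega) v' hv'
      exact ⟨r, by omega, by omega, by linarith [dist_triangle4 w v v' (f r)]⟩
    · rcases Nat.lt_or_ge (t + T) b with hlt | hge
      · obtain ⟨r, h1, h2, h3⟩ := hP _ b (by omega) (by omega) v' hv'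
        exfalso
        have h4 : dist (f t) (f r) ≤ 2 * s + 2 * h := by
          have h5 := dist_triangle4 w v v' (f r)
          have h6 := dist_triangle_left (f t) (f r) w
          linarith
        have h5 := hq t r (by omega) (by omega)
        have h6 : (t : ℝ) + T ≤ r := by exact_mod_cast (by omega : t + T ≤ r)
        have := mul_le_mul_of_nonneg_left h4 hK
        linarith
      · rw [min_eq_left hge] at hv'
        have := hL1 _ _ (by simp) v' hv'
        exact ⟨b, hab, le_rfl, by linarith [dist_triangle4 w v v' (f b)]⟩

theorem exists_forall_mul_le_two_pow (A : ℝ) : ∃ k₀ : ℕ, ∀ k ≥ k₀, A * (k + 1) ≤ 2 ^ k := by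
  have h := tendsto_pow_const_div_const_pow_of_one_lt 1 (r := (2 : ℝ)) (by norm_num)
  have h2 := h.eventually (gt_mem_nhds (show (0 : ℝ) < 1 / (2 * (|A| + 1)) by positivity))
  obtain ⟨k₀, hk₀⟩ := Filter.eventually_atTop.1 h2
  refine ⟨max k₀ 1, fun k hk => ?_⟩
  have h3 := hk₀ k (le_of_max_le_left hk)
  have h4 : (1 : ℝ) ≤ k := by exact_mod_cast le_of_max_le_right hk
  rw [div_lt_div_iff₀ (by positivity) (by positivity)] at h3
  have h5 : A ≤ |A| + 1 := by linarith [le_abs_self A]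
  have h6 : A * (k + 1) ≤ (|A| + 1) * (2 * k) := by gcongr; linarith
  nlinarith

/-- Start from the logarithmic bound, which depends on the length of the chain, and lower it by one
unit at a time. The bootstrap improves every bound above a threshold independent of the chain. -/
theorem exists_stability {L : X → X → Set X} {h : ℝ} (h0 : 0 ≤ h)
    (hL : ∀ x y z, ∀ w ∈ L x y, ∃ v ∈ L x z ∪ L z y, dist w v ≤ h)
    (hL1 : ∀ x y, dist x y ≤ 1 → ∀ w ∈ L x y, dist w x ≤ h) {K : ℝ} (hK : 0 ≤ K) :
    ∃ M : ℕ, ∀ (f : ℕ → X) (n : ℕ), (∀ i < n, dist (f i) (f (i + 1)) ≤ 1) →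
      (∀ i j, i ≤ j → j ≤ n → (j : ℝ) - i ≤ K * dist (f i) (f j) + K) →
      ∀ a b, a ≤ b → b ≤ n → ∀ w ∈ L (f a) (f b), ∃ t, a ≤ t ∧ t ≤ b ∧ dist w (f t) ≤ M := by
  obtain ⟨N, hN⟩ := exists_nat_ge (max h 1)
  have hNh : h ≤ N := (le_max_left _ _).trans hN
  have hN1 : (1 : ℝ) ≤ N := (le_max_right _ _).trans hN
  have hNpos : 0 < N := by exact_mod_cast (by linarith : (0 : ℝ) < N)
  obtain ⟨k₀, hk₀⟩ := exists_forall_mul_le_two_pow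
    (2 * (K * (2 * (N * 5 + 1) + 2 * h) + K + 2))
  refine ⟨N * (k₀ + 5), fun f n hf hq => ?_⟩
  have step : ∀ s : ℕ, N * (k₀ + 5) ≤ s →
      (∀ a b, a ≤ b → b ≤ n → ∀ w ∈ L (f a) (f b),
        ∃ t, a ≤ t ∧ t ≤ b ∧ dist w (f t) ≤ ((s + 1 : ℕ) : ℝ)) →
      (∀ a b, a ≤ b → b ≤ n → ∀ w ∈ L (f a) (f b),
        ∃ t, a ≤ t ∧ t ≤ b ∧ dist w (f t) ≤ (s : ℝ)) := by
    intro s hs hP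
    -- This `k` makes the improved bound `3 * h + h * (k + 1)` at most `N * (k + 4) ≤ s`, while `s ≤
    -- N * (k + 5)` keeps `T` linear in `k`, hence below `2 ^ k / 2` for `k ≥ k₀`.
    obtain ⟨k, hk⟩ : ∃ k, s / N = k + 4 := ⟨s / N - 4, by
      have : k₀ + 5 ≤ s / N := (Nat.le_div_iff_mul_le hNpos).2 (by linarith)
      omega⟩
    have hkk : k₀ ≤ k := by
      have : k₀ + 5 ≤ s / N := (Nat.le_div_iff_mul_le hNpos).2 (by linarith)
      omega
    have hs1 : N * (k + 4) ≤ s := by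
      have := Nat.mul_div_le s N
      rwa [hk] at this
    have hs2 : s ≤ N * (k + 5) := by
      have := Nat.lt_mul_div_succ s hNpos
      rw [hk] at this
      exact this.le
    have hs1' : (N : ℝ) * (k + 4) ≤ s := by exact_mod_cast hs1
    have hs2' : (s : ℝ) ≤ N * (k + 5) := by exact_mod_cast hs2
    have hk0 : (0 : ℝ) ≤ k := by positivity
    set Y : ℝ := K * (2 * ((s + 1 : ℕ) : ℝ) + 2 * h) + K with hY
    have hY0 : 0 ≤ Y := by positivity
    have hYle : Y + 2 ≤ (K * (2 * (N * 5 + 1) + 2 * h) + K + 2) * (k + 1) := by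
      have e1 : ((s + 1 : ℕ) : ℝ) ≤ (N * 5 + 1) * (k + 1) := by
        push_cast
        nlinarith
      have e2 : 2 * ((s + 1 : ℕ) : ℝ) + 2 * h ≤ (2 * (N * 5 + 1) + 2 * h) * (k + 1) := by
        nlinarith
      have e3 := mul_le_mul_of_nonneg_left e2 hK
      nlinarith
    have hT : Y < ((⌊Y⌋₊ + 1 : ℕ) : ℝ) := by
      push_cast
      exact Nat.lt_floor_add_one Y
    have hkT : 2 * (⌊Y⌋₊ + 1) ≤ 2 ^ k := by
      have e1 := Nat.floor_le hY0
      have e2 := hk₀ k hkk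
      have : (2 : ℝ) * (⌊Y⌋₊ + 1) ≤ 2 ^ k := by nlinarith
      exact_mod_cast this
    have := exists_dist_le_improve h0 hL hL1 hK (s := ((s + 1 : ℕ) : ℝ))
      (T := ⌊Y⌋₊ + 1) hT hkT hf hq hP
    intro a b hab hb w hw
    obtain ⟨t, h1, h2, h3⟩ := this a b hab hb w hw
    refine ⟨t, h1, h2, h3.trans (le_trans ?_ hs1')⟩
    nlinarith
  have descent : ∀ m : ℕ,
      (∀ a b, a ≤ b → b ≤ n → ∀ w ∈ L (f a) (f b),
        ∃ t, a ≤ t ∧ t ≤ b ∧ dist w (f t) ≤ ((N * (k₀ + 5) + m : ℕ) : ℝ)) →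
      (∀ a b, a ≤ b → b ≤ n → ∀ w ∈ L (f a) (f b),
        ∃ t, a ≤ t ∧ t ≤ b ∧ dist w (f t) ≤ ((N * (k₀ + 5) : ℕ) : ℝ)) := by
    intro m
    induction m with
    | zero => exact id
    | succ m ih => exact fun hm => ih (step _ (by omega) hm)
  refine descent ⌈h * (n + 1)⌉₊ fun a b hab hb w hw => ?_
  obtain ⟨t, h1, h2, h3⟩ := exists_dist_le_log hL hL1 hf n a b hab hb
    (by have := Nat.lt_two_pow_self (n := n); omega) w hw
  refine ⟨t, h1, h2, h3.trans ((Nat.le_ceil _).trans ?_)⟩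
  exact_mod_cast Nat.le_add_left _ _

/-- A quasigeodesic chain stays close to every coarsely connected set which stays close to it. -/
theorem exists_mem_dist_le_of_stability {f : ℕ → X} {n : ℕ} {K M : ℝ} (hK : 0 ≤ K) (hM : 0 ≤ M)
    (hf : ∀ i < n, dist (f i) (f (i + 1)) ≤ 1)
    (hq : ∀ i j, i ≤ j → j ≤ n → (j : ℝ) - i ≤ K * dist (f i) (f j) + K)
    {S : Set X} (hS : ∀ w ∈ S, ∃ t ≤ n, dist w (f t) ≤ M)
    {g : ℕ → X} {m : ℕ} (hg0 : g 0 = f 0) (hgm : g m = f n)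
    (hg : ∀ i < m, dist (g i) (g (i + 1)) ≤ 1) (hgS : ∀ i ≤ m, g i ∈ S) {t : ℕ} (ht : t ≤ n) :
    ∃ w ∈ S, dist (f t) w ≤ K * (2 * M + 1) + K + M := by
  -- Moving along `g`, the nearby parameters of `f` pass from at most `t` to at least `t`. Where
  -- this happens, one point `g i` is near `f u` and `f u'` with `u ≤ t ≤ u'`, and `hq` bounds `u' -
  -- u`.
  have key : ∀ i ≤ m, ∀ u u', u ≤ t → t ≤ u' → u' ≤ n → dist (g i) (f u) ≤ M →
      dist (g i) (f u') ≤ M + 1 → ∃ w ∈ S, dist (f t) w ≤ K * (2 * M + 1) + K + M := by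
    intro i hi u u' hu hu' hu'n h1 h2
    refine ⟨g i, hgS i hi, ?_⟩
    have h3 := hq u u' (by omega) hu'n
    have h4 : dist (f u) (f u') ≤ 2 * M + 1 := by
      linarith [dist_triangle_left (f u) (f u') (g i)]
    have h5 := dist_le_of_chain hf hu ht
    have h6 := mul_le_mul_of_nonneg_left h4 hK
    have h7 : (t : ℝ) ≤ u' := by exact_mod_cast hu'
    have h8 := dist_triangle (f t) (f u) (g i)
    rw [dist_comm (f t) (f u), dist_comm (f u) (g i)] at h8
    linarith
  by_cases hQ : ∃ u ≤ t, dist (g m) (f u) ≤ M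
  · obtain ⟨u, hu, hd⟩ := hQ
    exact key m le_rfl u n hu ht le_rfl hd (by rw [hgm, dist_self]; linarith)
  · obtain ⟨i, him, ⟨u, hu, hd⟩, hn⟩ := exists_step_of_not
      (Q := fun i => ∃ u ≤ t, dist (g i) (f u) ≤ M) ⟨0, Nat.zero_le _, by simpa [hg0]⟩ hQ
    obtain ⟨u', hu'n, hd'⟩ := hS _ (hgS (i + 1) him)
    refine key i him.le u u' hu ?_ hu'n hd ?_
    · by_contra! hlt
      exact hn ⟨u', hlt.le, hd'⟩
    · linarith [hg i him, dist_triangle (g i) (g (i + 1)) (f u')]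

end Stability

/-! Discrete hyperbolic spaces -/

section DiscreteHyperbolic

variable {X : Type u} [MetricSpace X]

/-- The interval between `x` and `y`: the union of all geodesics from `x` to `y`. -/
def interval (x y : X) : Set X := {z | dist x z + dist z y = dist x y}

/-- Any two points are joined by a discrete geodesic. -/
def IsDiscretelyGeodesic (X : Type u) [MetricSpace X] : Prop :=
  ∀ x y : X, ∃ (n : ℕ) (f : ℕ → X), f 0 = x ∧ f n = y ∧
    ∀ s ≤ n, ∀ t ≤ n, dist (f s) (f t) = |(s : ℝ) - t|

/-- All triangles of intervals are `h`-slim. -/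
def SlimIntervals (h : ℝ) (X : Type u) [MetricSpace X] : Prop :=
  ∀ x y z : X, ∀ w ∈ interval x y, ∃ v ∈ interval x z ∪ interval z y, dist w v ≤ h

/-- Gromov's four point condition. -/
def FourPoint (δ : ℝ) (X : Type u) [MetricSpace X] : Prop :=
  ∀ x y z w : X, dist x z + dist y w ≤ max (dist x y + dist z w) (dist x w + dist y z) + δ

/-- Intervals with end points in `A` are contained in the `D`-neighbourhood of `A`. -/
def QuasiConvex (D : ℝ) (A : Set X) : Prop :=
  ∀ a ∈ A, ∀ b ∈ A, ∀ z ∈ interval a b, ∃ y ∈ A, dist z y ≤ D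

/-- Going from a point to `A` through a closest point is efficient up to `C`. -/
def EfficientProj (C : ℝ) (A : Set X) : Prop :=
  ∀ x, ∀ y ∈ closestPts A x, ∀ a ∈ A, dist x y + dist y a ≤ dist x a + C

theorem interval_symm {x y z : X} (h : z ∈ interval x y) : z ∈ interval y x := by
  simp only [interval, Set.mem_ofPred_eq] at h ⊢
  rw [dist_comm y z, dist_comm z x, dist_comm y x]
  linarith

theorem left_mem_interval (x y : X) : x ∈ interval x y := by simp [interval]

theorem right_mem_interval (x y : X) : y ∈ interval x y := by simp [interval]

theorem dist_add_dist_le_of_near_interval {a b p q : X} {e : ℝ} (hq : q ∈ interval a b)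
    (h : dist p q ≤ e) : dist a p + dist p b ≤ dist a b + 2 * e := by
  simp only [interval, Set.mem_ofPred_eq] at hq
  have h1 := dist_triangle a q p
  have h2 := dist_triangle p q b
  rw [dist_comm q p] at h1
  linarith

theorem IsDiscretelyGeodesic.exists_path (hX : IsDiscretelyGeodesic X) (x y : X) :
    ∃ (n : ℕ) (f : ℕ → X), dist x y = n ∧ f 0 = x ∧ f n = y ∧
      (∀ s ≤ n, ∀ t ≤ n, dist (f s) (f t) = |(s : ℝ) - t|) ∧
      ∀ s ≤ n, f s ∈ interval x y ∧ dist x (f s) = s := by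
  obtain ⟨n, f, h0, hn, hf⟩ := hX x y
  have hd : dist x y = n := by
    rw [← h0, ← hn, hf 0 (Nat.zero_le _) n le_rfl]
    simp
  refine ⟨n, f, hd, h0, hn, hf, fun s hs => ?_⟩
  have h1 := hf 0 (Nat.zero_le _) s hs
  have h2 := hf s hs n le_rfl
  have h3 : (s : ℝ) ≤ n := by exact_mod_cast hs
  rw [h0, Nat.cast_zero, zero_sub, abs_neg, Nat.abs_cast] at h1
  rw [hn, abs_sub_comm, abs_of_nonneg (by linarith)] at h2
  refine ⟨?_, h1⟩
  simp only [interval, Set.mem_ofPred_eq]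
  linarith

theorem IsDiscretelyGeodesic.exists_nat (hX : IsDiscretelyGeodesic X) (x y : X) :
    ∃ n : ℕ, dist x y = n := by
  obtain ⟨n, -, h, -⟩ := hX.exists_path x y
  exact ⟨n, h⟩

theorem IsDiscretelyGeodesic.exists_between (hX : IsDiscretelyGeodesic X) (x y : X) {r : ℕ}
    (hr : r ≤ dist x y) : ∃ z ∈ interval x y, dist x z = r := by
  obtain ⟨n, f, h, -, -, -, hf⟩ := hX.exists_path x y
  rw [h] at hr
  exact ⟨f r, hf r (by exact_mod_cast hr)⟩

theorem IsDiscretelyGeodesic.exists_between_dist (hX : IsDiscretelyGeodesic X) (x y a b : X)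
    (hr : dist a b ≤ dist x y) : ∃ z ∈ interval x y, dist x z = dist a b := by
  obtain ⟨n, hn⟩ := hX.exists_nat a b
  rw [hn] at hr ⊢
  exact hX.exists_between x y hr

theorem IsDiscretelyGeodesic.closestPts_nonempty (hX : IsDiscretelyGeodesic X) {A : Set X}
    (hA : A.Nonempty) (x : X) : (closestPts A x).Nonempty := by
  classical
  choose d hd using hX.exists_nat
  obtain ⟨a, ha⟩ := hA
  have hex : ∃ n, ∃ a ∈ A, d x a = n := ⟨_, a, ha, rfl⟩
  obtain ⟨y, hy, hyd⟩ := Nat.find_spec hex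
  refine ⟨y, hy, fun b hb => ?_⟩
  rw [hd, hd, hyd]
  exact_mod_cast Nat.find_min' hex ⟨b, hb, rfl⟩

theorem SlimIntervals.fourPoint {h : ℝ} (hs : SlimIntervals h X) (hX : IsDiscretelyGeodesic X)
    (h0 : 0 ≤ h) : FourPoint (4 * h + 2) X := by
  intro x y z w
  -- A coarse centre of the triangle `x, y, z` on the side from `x` to `z`: the last point before a
  -- geodesic leaves the neighbourhood of the side from `x` to `y`. Comparing `p` with the triangle
  -- `x, w, z` selects the term of the maximum.
  obtain ⟨p, hp, hp1, hp2⟩ : ∃ p ∈ interval x z, (∃ q ∈ interval x y, dist p q ≤ h + 1) ∧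
      ∃ q ∈ interval y z, dist p q ≤ h + 1 := by
    obtain ⟨n, g, hd, g0, gn, hg, hgi⟩ := hX.exists_path x z
    by_cases hQ : ∃ q ∈ interval x y, dist (g n) q ≤ h
    · obtain ⟨q, hq, hqd⟩ := hQ
      refine ⟨g n, (hgi n le_rfl).1, ⟨q, hq, by linarith⟩, z, right_mem_interval _ _, ?_⟩
      rw [gn, dist_self]
      linarith
    · obtain ⟨i, hi, ⟨q, hq, hqd⟩, hn⟩ := exists_step_of_not
        (Q := fun i => ∃ q ∈ interval x y, dist (g i) q ≤ h)
        ⟨x, left_mem_interval _ _, by simpa [g0] using h0⟩ hQ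
      refine ⟨g i, (hgi i hi.le).1, ⟨q, hq, by linarith⟩, ?_⟩
      obtain ⟨v, hv | hv, hvd⟩ := hs x z y (g (i + 1)) (hgi _ hi).1
      · exact absurd ⟨v, hv, hvd⟩ hn
      · refine ⟨v, hv, ?_⟩
        have h1 := hg i hi.le (i + 1) hi
        push_cast at h1
        rw [show (i : ℝ) - (i + 1) = -1 by ring, abs_neg, abs_one] at h1
        linarith [dist_triangle (g i) (g (i + 1)) v]
  obtain ⟨q, hq, hqd⟩ := hp1
  obtain ⟨q', hq', hqd'⟩ := hp2
  have e1 := dist_add_dist_le_of_near_interval hq hqd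
  have e2 := dist_add_dist_le_of_near_interval hq' hqd'
  have e3 := dist_triangle y p w
  simp only [interval, Set.mem_ofPred_eq] at hp
  obtain ⟨v, hv | hv, hvd⟩ := hs x z w p hp
  · have e4 := dist_add_dist_le_of_near_interval hv hvd
    linarith [le_max_right (dist x y + dist z w) (dist x w + dist y z)]
  · have e4 := dist_add_dist_le_of_near_interval hv hvd
    rw [dist_comm w p, dist_comm w z] at e4
    rw [dist_comm p y] at e1
    linarith [le_max_left (dist x y + dist z w) (dist x w + dist y z)]

/-- Compare `y` with the point of a geodesic at the same distance from `a`, or with `b` if `y` is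
too far from `a`. -/
theorem FourPoint.exists_interval_near {δ : ℝ} (h4 : FourPoint δ X) (h0 : 0 ≤ δ)
    (hX : IsDiscretelyGeodesic X) {a b y : X} {c : ℝ}
    (h : dist a y + dist y b ≤ dist a b + c) : ∃ z ∈ interval a b, dist y z ≤ c + δ := by
  have hc : 0 ≤ c := by linarith [dist_triangle a y b]
  rcases le_or_gt (dist a y) (dist a b) with hle | hlt
  · obtain ⟨z, hz, hd⟩ := hX.exists_between_dist a b a y hle
    refine ⟨z, hz, ?_⟩
    simp only [interval, Set.mem_ofPred_eq] at hz
    have h1 := h4 y a z b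
    have h2 : max (dist y a + dist z b) (dist y b + dist a z) ≤ dist a b + c :=
      max_le (by rw [dist_comm y a]; linarith) (by linarith)
    linarith
  · exact ⟨b, right_mem_interval _ _, by linarith⟩

theorem QuasiConvex.exists_near {D δ : ℝ} {A : Set X} (hA : QuasiConvex D A)
    (h4 : FourPoint δ X) (h0 : 0 ≤ δ) (hX : IsDiscretelyGeodesic X) {a b y : X} {c : ℝ}
    (ha : a ∈ A) (hb : b ∈ A) (h : dist a y + dist y b ≤ dist a b + c) :
    ∃ z ∈ A, dist y z ≤ c + δ + D := by
  obtain ⟨z, hz, hd⟩ := h4.exists_interval_near h0 hX h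
  obtain ⟨w, hw, hwd⟩ := hA a ha b hb z hz
  exact ⟨w, hw, by linarith [dist_triangle y z w]⟩

/-- Move from `y` towards `a` by the least integer `r > D + δ`. In the four point condition for `x,
y, z, a`, one case would put a point of `A` closer to `x` than `y`; the other is the desired
estimate. -/
theorem QuasiConvex.efficientProj {D δ : ℝ} {A : Set X} (hA : QuasiConvex D A)
    (h4 : FourPoint δ X) (h0 : 0 ≤ δ) (hD : 0 ≤ D) (hX : IsDiscretelyGeodesic X) :
    EfficientProj (2 * D + 2 * δ + 1) A := by
  intro x y hy a ha
  have hr1 : D + δ < ((⌊D + δ⌋₊ + 1 : ℕ) : ℝ) := by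
    push_cast
    exact Nat.lt_floor_add_one _
  have hr2 : ((⌊D + δ⌋₊ + 1 : ℕ) : ℝ) ≤ D + δ + 1 := by
    push_cast
    linarith [Nat.floor_le (by positivity : 0 ≤ D + δ)]
  rcases le_or_gt ((⌊D + δ⌋₊ + 1 : ℕ) : ℝ) (dist y a) with hle | hlt
  · obtain ⟨z, hz, hd⟩ := hX.exists_between y a hle
    obtain ⟨w, hw, hwd⟩ := hA y hy.1 a ha z hz
    have h1 := h4 x y z a
    have h2 := hy.2 w hw
    have h3 := dist_triangle x z w
    simp only [interval, Set.mem_ofPred_eq] at hz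
    rcases max_cases (dist x y + dist z a) (dist x a + dist y z) with h | h <;> linarith
  · have := hy.2 a ha
    linarith

end DiscreteHyperbolic

/-! Closest point projections -/

section Projections

variable {X : Type u} [MetricSpace X] {C δ : ℝ}

theorem EfficientProj.dist_le {A : Set X} (hA : EfficientProj C A) {x y y' : X}
    (hy : y ∈ closestPts A x) (hy' : y' ∈ closestPts A x) : dist y y' ≤ C := by
  linarith [hA x y hy y' hy'.1, hy'.2 y hy.1]

theorem EfficientProj.dist_le_dist_add {A : Set X} (hA : EfficientProj C A) {x x' y y' : X}
    (hy : y ∈ closestPts A x) (hy' : y' ∈ closestPts A x') : dist y y' ≤ dist x x' + C := by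
  have h1 := hA x y hy y' hy'.1
  have h2 := hA x' y' hy' y hy.1
  have h3 := dist_triangle x x' y'
  have h4 := dist_triangle x' x y
  rw [dist_comm x' x] at h4
  rw [dist_comm y' y] at h2
  linarith

/-- Adding the two efficiency estimates rules out the term `dist x y + dist x' y'` in the four point
condition once the projections are more than `C + δ` apart. -/
theorem EfficientProj.contracting {A : Set X} (hA : EfficientProj C A) (h4 : FourPoint δ X)
    (h0 : 0 ≤ δ) {x x' y y' : X} (hy : y ∈ closestPts A x) (hy' : y' ∈ closestPts A x')
    (h : C + δ < dist y y') :
    dist x y + dist y y' + dist y' x' ≤ dist x x' + (2 * C + δ) := by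
  have h1 := hA x y hy y' hy'.1
  have h2 := hA x' y' hy' y hy.1
  have h3 := h4 x x' y' y
  rw [dist_comm y' y] at h2 h3
  rw [dist_comm y' x']
  rcases max_cases (dist x x' + dist y y') (dist x y + dist x' y') with h | h <;> linarith

/-- The transversal consistency inequality: if `x` and its projection `v` to `A` project far apart
on `B`, then going from `x` to `v` almost passes through `w'`, so projecting `w'` back to `A` lands
near `v`. -/
theorem EfficientProj.dist_le_of_contracting {A B : Set X} (hA : EfficientProj C A)
    (hB : EfficientProj C B) (h4 : FourPoint δ X) (h0 : 0 ≤ δ) {x v u w w' : X} (hv : v ∈ closestPts A x)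
    (hw : w ∈ closestPts B x) (hw' : w' ∈ closestPts B v) (hu : u ∈ closestPts A w')
    (h : C + δ < dist w w') : dist v u ≤ 3 * C + δ := by
  have h1 := hB.contracting h4 h0 hw hw' h
  have h2 := hA x v hv u hu.1
  have h3 := hu.2 v hv.1
  have h5 := dist_triangle4 x w w' u
  linarith

theorem EfficientProj.exists_near_of_far {A B : Set X} {D : ℝ} (hA : EfficientProj C A)
    (h4 : FourPoint δ X) (h0 : 0 ≤ δ) (hX : IsDiscretelyGeodesic X) (hB : QuasiConvex D B)
    {x x' y y' : X} (hx : x ∈ B) (hx' : x' ∈ B) (hy : y ∈ closestPts A x)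
    (hy' : y' ∈ closestPts A x') (h : C + δ < dist y y') :
    ∃ z ∈ B, dist y z ≤ 2 * C + 2 * δ + D := by
  have h1 := hA.contracting h4 h0 hy hy' h
  have h2 := dist_triangle y y' x'
  obtain ⟨z, hz, hd⟩ := hB.exists_near h4 h0 hX hx hx'
    (show dist x y + dist y x' ≤ dist x x' + (2 * C + δ) by linarith)
  exact ⟨z, hz, by linarith⟩

/-- Twice the position of the projection of `z` to a geodesic from `x` to `x'`. -/
def coord (x x' z : X) : ℝ := dist x z + dist x x' - dist z x'

theorem coord_left (x x' : X) : coord x x' x = 0 := by simp [coord]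

theorem coord_right (x x' : X) : coord x x' x' = 2 * dist x x' := by
  simp [coord]
  ring

theorem coord_nonneg (x x' z : X) : 0 ≤ coord x x' z := by
  have := dist_triangle z x x'
  rw [dist_comm z x] at this
  simp only [coord]
  linarith

theorem coord_le (x x' z : X) : coord x x' z ≤ 2 * dist x x' := by
  have := dist_triangle x x' z
  rw [dist_comm x' z] at this
  simp only [coord]
  linarith

theorem coord_sub_le (x x' z z' : X) : coord x x' z' - coord x x' z ≤ 2 * dist z z' := by
  have h1 := dist_triangle x z z'
  have h2 := dist_triangle z z' x'
  simp only [coord]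
  linarith

/-- Points of the interval from `x` to `x'` with (double) position between `l` and `u` are
`ε`-close to `A`. -/
def NearOn (ε : ℝ) (A : Set X) (x x' : X) (l u : ℝ) : Prop :=
  ∀ p ∈ interval x x', l ≤ 2 * dist x p → 2 * dist x p ≤ u → ∃ a ∈ A, dist p a ≤ ε

/-- Three uses of the four point condition: the order of positions fixes the maximum when estimating
the distances from `p` to `z` and to `z'`, and the gap `δ` fixes it for `z, z', x', x`. -/
theorem FourPoint.dist_add_dist_le_of_coord (h4 : FourPoint δ X) {x x' z z' p : X}
    (hp : p ∈ interval x x') (h1 : coord x x' z ≤ 2 * dist x p) (h2 : 2 * dist x p ≤ coord x x' z')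
    (h : δ < coord x x' z' - coord x x' z) : dist z p + dist p z' ≤ dist z z' + 3 * δ := by
  simp only [coord, interval, Set.mem_ofPred_eq] at *
  have e1 := h4 z x p x'
  have e2 := h4 x z' p x'
  have e3 := h4 z z' x' x
  have e4 := dist_comm z x
  have e5 := dist_comm z' x
  have e6 := dist_comm z' p
  have e7 := dist_comm x' x
  have e3' := dist_comm z' x'
  have m1 : max (dist z x + dist p x') (dist z x' + dist x p) ≤ dist z x' + dist x p :=
    max_le (by linarith) le_rfl
  have e2' := h4 p x z' x'
  have e8 := dist_comm p x
  have m2 : max (dist p x + dist z' x') (dist p x' + dist x z') ≤ dist p x' + dist x z' :=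
    max_le (by linarith) le_rfl
  rcases max_cases (dist z z' + dist x' x) (dist z x + dist z' x') with m | m <;> linarith

theorem QuasiConvex.nearOn {D : ℝ} {A : Set X} (hA : QuasiConvex D A) (h4 : FourPoint δ X)
    (h0 : 0 ≤ δ) (hX : IsDiscretelyGeodesic X) {x x' z z' : X} (hz : z ∈ A) (hz' : z' ∈ A)
    (h : δ < coord x x' z' - coord x x' z) :
    NearOn (4 * δ + D) A x x' (coord x x' z) (coord x x' z') := by
  intro p hp h1 h2
  obtain ⟨a, ha, hd⟩ := hA.exists_near h4 h0 hX hz hz' (h4.dist_add_dist_le_of_coord hp h1 h2 h)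
  exact ⟨a, ha, by linarith⟩

theorem EfficientProj.le_coord_sub {A : Set X} (hA : EfficientProj C A) {x x' y y' : X}
    (hy : y ∈ closestPts A x) (hy' : y' ∈ closestPts A x') :
    2 * dist y y' - 2 * C ≤ coord x x' y' - coord x x' y := by
  have h1 := hA x y hy y' hy'.1
  have h2 := hA x' y' hy' y hy.1
  rw [dist_comm y' y, dist_comm x' y', dist_comm x' y] at h2
  simp only [coord]
  linarith

/-- Round the halved ends of the range inwards to integer parameters of a geodesic; the extra `2`
pays for both roundings. -/
theorem IsDiscretelyGeodesic.exists_pair (hX : IsDiscretelyGeodesic X) {R : ℝ} {x x' : X}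
    {a b : ℝ} (ha0 : 0 ≤ a)
    (hb0 : b ≤ 2 * dist x x') (hR : 0 ≤ R) (hab : 2 * (R + 2) ≤ b - a) :
    ∃ p ∈ interval x x', ∃ p' ∈ interval x x', a ≤ 2 * dist x p ∧ 2 * dist x p ≤ b ∧
      a ≤ 2 * dist x p' ∧ 2 * dist x p' ≤ b ∧ dist x p' = dist x p + dist p p' ∧
      R < dist p p' := by
  obtain ⟨n, f, hd, f0, fn, hf, hfi⟩ := hX.exists_path x x'
  have h1 := Nat.le_ceil (a / 2)
  have h2 := Nat.ceil_lt_add_one (show 0 ≤ a / 2 by linarith)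
  have h3 := Nat.floor_le (show 0 ≤ b / 2 by linarith)
  have h4 := Nat.lt_floor_add_one (b / 2)
  have h5 : ((⌊b / 2⌋₊ : ℕ) : ℝ) ≤ n := by linarith
  have h5' : ⌊b / 2⌋₊ ≤ n := by exact_mod_cast h5
  have h6 : ((⌈a / 2⌉₊ : ℕ) : ℝ) ≤ n := by linarith
  have h6' : ⌈a / 2⌉₊ ≤ n := by exact_mod_cast h6
  have h7 := hf _ h6' _ h5'
  rw [abs_sub_comm, abs_of_nonneg (by linarith)] at h7
  refine ⟨f ⌈a / 2⌉₊, (hfi _ h6').1, f ⌊b / 2⌋₊, (hfi _ h5').1, ?_⟩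
  rw [(hfi _ h6').2, (hfi _ h5').2, h7]
  refine ⟨?_, ?_, ?_, ?_, ?_, ?_⟩ <;> linarith

/-- Over the common range `[max l l', min u u']` every interval point is `ε`-close to both sets, so
points of `B` chosen near two distant interval points lie in the `2 * ε`-neighbourhood of `A`. -/
theorem NearOn.exists_far_pair {ε R : ℝ} {A B : Set X} {x x' : X} {l u l' u' : ℝ}
    (hX : IsDiscretelyGeodesic X) (hA : NearOn ε A x x' l u) (hB : NearOn ε B x x' l' u')
    (hl : 0 ≤ l) (hu : u ≤ 2 * dist x x') (hε : 0 ≤ ε) (hR : 0 ≤ R)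
    (h1 : 2 * (R + 2 * ε + 2) ≤ u - l) (h2 : 2 * (R + 2 * ε + 2) ≤ u' - l')
    (h3 : 2 * (R + 2 * ε + 2) ≤ u' - l) (h5 : 2 * (R + 2 * ε + 2) ≤ u - l') :
    ¬ DiamLE (nbhd (2 * ε) A ∩ B) R := by
  intro hdiam
  obtain ⟨p, hp, p', hp', e1, e2, e3, e4, -, e5⟩ := hX.exists_pair (a := max l l')
    (b := min u u') (R := R + 2 * ε) (hl.trans (le_max_left _ _)) ((min_le_left _ _).trans hu)
    (by linarith)
    (by rcases max_cases l l' with m | m <;> rcases min_cases u u' with m' | m' <;> linarith)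
  have key : ∀ p ∈ interval x x', max l l' ≤ 2 * dist x p → 2 * dist x p ≤ min u u' →
      ∃ b ∈ nbhd (2 * ε) A ∩ B, dist p b ≤ ε := by
    intro p hp h h'
    obtain ⟨a, ha, hda⟩ := hA p hp (le_of_max_le_left h) (le_min_iff.1 h').1
    obtain ⟨b, hb, hdb⟩ := hB p hp (le_of_max_le_right h) (le_min_iff.1 h').2
    exact ⟨b, ⟨⟨a, ha, by linarith [dist_triangle_left b a p]⟩, hb⟩, hdb⟩
  obtain ⟨b, hb, hdb⟩ := key p hp e1 e2
  obtain ⟨b', hb', hdb'⟩ := key p' hp' e3 e4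
  have := hdiam b hb b' hb'
  have h6 := dist_triangle4 p b b' p'
  rw [dist_comm b' p'] at h6
  linarith

end Projections

/-! Discrete geodesics -/

section Geodesics

/-- `f` restricts to an isometric embedding of `{0, …, n}`. -/
def IsIsometricPath {Y : Type u} [MetricSpace Y] (n : ℕ) (f : ℕ → Y) : Prop :=
  ∀ s ≤ n, ∀ t ≤ n, dist (f s) (f t) = |(s : ℝ) - t|

variable {X Y : Type u} [MetricSpace X] [MetricSpace Y]

theorem IsIsometricPath.dist_succ {n : ℕ} {f : ℕ → Y} (hf : IsIsometricPath n f) {i : ℕ}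
    (hi : i < n) : dist (f i) (f (i + 1)) = 1 := by
  rw [hf i hi.le (i + 1) hi]
  push_cast
  rw [show (i : ℝ) - (i + 1) = -1 by ring, abs_neg, abs_one]

theorem IsIsometricPath.dist_eq {n : ℕ} {f : ℕ → Y} (hf : IsIsometricPath n f) {i j : ℕ}
    (hij : i ≤ j) (hj : j ≤ n) : dist (f i) (f j) = (j : ℝ) - i := by
  have : (i : ℝ) ≤ j := by exact_mod_cast hij
  rw [hf i (hij.trans hj) j hj, abs_sub_comm, abs_of_nonneg (by linarith)]

theorem IsIsometricPath.isGeodesic {n : ℕ} {f : ℕ → Y} (hf : IsIsometricPath n f) :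
    IsGeodesic (f '' Set.Icc 0 n) (f 0) (f n) :=
  Or.inr ⟨n, f, rfl, rfl, fun s hs t ht => hf s hs.2 t ht.2, rfl⟩

theorem IsDiscretelyGeodesic.exists_isometricPath (hX : IsDiscretelyGeodesic X) {γ : Set X}
    {x y : X} (hγ : IsGeodesic γ x y) :
    ∃ (n : ℕ) (f : ℕ → X), f 0 = x ∧ f n = y ∧ IsIsometricPath n f ∧ γ = f '' Set.Icc 0 n := by
  obtain ⟨L, f, hL, h0, hL', hf, rfl⟩ | ⟨n, f, h0, hn, hf, rfl⟩ := hγ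
  -- Distances are natural numbers, so a geodesic parametrised by a real interval must be constant.
  · obtain rfl : L = 0 := by
      by_contra hne
      have hpos : 0 < L := lt_of_le_of_ne hL (Ne.symm hne)
      have hm : 0 < min L (1 / 2) := lt_min hpos (by norm_num)
      have h1 := hf 0 ⟨le_rfl, hL⟩ (min L (1 / 2)) ⟨hm.le, min_le_left _ _⟩
      rw [zero_sub, abs_neg, abs_of_pos hm] at h1
      obtain ⟨k, hk⟩ := hX.exists_nat (f 0) (f (min L (1 / 2)))
      rw [hk] at h1
      have h2 : (k : ℝ) < 1 := by
        rw [h1]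
        exact (min_le_right _ _).trans_lt (by norm_num)
      have h3 : (0 : ℝ) < k := by rwa [h1]
      have h2' : k < 1 := by exact_mod_cast h2
      have h3' : 0 < k := by exact_mod_cast h3
      omega
    refine ⟨0, fun _ => x, rfl, by rw [← hL', h0], fun s hs t ht => ?_, by simp [h0]⟩
    obtain rfl : s = 0 := by omega
    obtain rfl : t = 0 := by omega
    simp
  · exact ⟨n, f, h0, hn, fun s hs t ht => hf s ⟨Nat.zero_le _, hs⟩ t ⟨Nat.zero_le _, ht⟩, rfl⟩

/-- Concatenating geodesics at a point of the interval gives a chain of the minimal length, hence a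
geodesic. -/
theorem IsDiscretelyGeodesic.mem_isometricPath (hX : IsDiscretelyGeodesic X) {x y z : X}
    (hz : z ∈ interval x y) : ∃ (n : ℕ) (f : ℕ → X), f 0 = x ∧ f n = y ∧ IsIsometricPath n f ∧
      z ∈ f '' Set.Icc 0 n := by
  obtain ⟨n, f, hd, f0, fn, hf, -⟩ := hX.exists_path x z
  obtain ⟨m, g, hd', g0, gm, hg, -⟩ := hX.exists_path z y
  have hch : ∀ i < n + m, dist (if i ≤ n then f i else g (i - n))
      (if i + 1 ≤ n then f (i + 1) else g (i + 1 - n)) ≤ 1 := by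
    intro i hi
    rcases lt_trichotomy i n with h | h | h
    · rw [if_pos h.le, if_pos (show i + 1 ≤ n from h), IsIsometricPath.dist_succ hf h]
    · subst h
      have := IsIsometricPath.dist_succ hg (i := 0) (by omega)
      rw [if_pos le_rfl, if_neg (by omega), fn, ← g0, Nat.add_sub_cancel_left, this]
    · rw [if_neg (by omega), if_neg (by omega), Nat.sub_add_comm h.le,
        IsIsometricPath.dist_succ hg (by omega)]
  have hend : (if n + m ≤ n then f (n + m) else g (n + m - n)) = y := by
    split_ifs with h
    · obtain rfl : m = 0 := by omega
      rw [add_zero, fn, ← g0, gm]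
    · rw [Nat.add_sub_cancel_left, gm]
  refine ⟨n + m, fun i => if i ≤ n then f i else g (i - n), by simpa using f0, hend, ?_,
    n, ⟨Nat.zero_le _, by omega⟩, by simpa using fn⟩
  intro s hs t ht
  refine dist_eq_of_chain (f := fun i => if i ≤ n then f i else g (i - n)) hch ?_ hs ht
  simp only [interval, Set.mem_ofPred_eq] at hz
  simp only [hend]
  simp only [Nat.zero_le, if_true, f0]
  push_cast
  linarith

theorem IsHyperbolicSpace.slimIntervals {δ : ℝ} (h : IsHyperbolicSpace δ X)
    (hX : IsDiscretelyGeodesic X) : SlimIntervals δ X := by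
  intro x y z w hw
  obtain ⟨n, f, f0, fn, hf, hwf⟩ := hX.mem_isometricPath hw
  obtain ⟨m, g, -, g0, gm, hg, hgi⟩ := hX.exists_path y z
  obtain ⟨k, e, -, e0, ek, he, hei⟩ := hX.exists_path x z
  obtain ⟨q, hq, hqd⟩ := h.slim x y z _ _ _ (f0 ▸ fn ▸ hf.isGeodesic)
    (g0 ▸ gm ▸ IsIsometricPath.isGeodesic hg) (e0 ▸ ek ▸ IsIsometricPath.isGeodesic he) w hwf
  refine ⟨q, ?_, hqd⟩
  obtain ⟨s, hs, rfl⟩ | ⟨s, hs, rfl⟩ := hq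
  · exact Or.inr (interval_symm (hgi s hs.2).1)
  · exact Or.inl (hei s hs.2).1

/-- Isometric paths of spaces which are quasi-isometrically embedded in `X` are close to the
members of a slim family of coarsely connected sets. -/
theorem exists_stability_isometricPath {L : X → X → Set X} {h : ℝ} (h0 : 0 ≤ h)
    (hL : ∀ x y z, ∀ w ∈ L x y, ∃ v ∈ L x z ∪ L z y, dist w v ≤ h)
    (hL1 : ∀ x y, dist x y ≤ 1 → ∀ w ∈ L x y, dist w x ≤ h)
    (hLc : ∀ x y, ∃ (m : ℕ) (g : ℕ → X), g 0 = x ∧ g m = y ∧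
      (∀ i < m, dist (g i) (g (i + 1)) ≤ 1) ∧ ∀ i ≤ m, g i ∈ L x y) {K : ℝ} (hK : 0 ≤ K) :
    ∃ M : ℝ, 0 ≤ M ∧ ∀ (Y : Type u) [MetricSpace Y] (φ : Y → X),
      (∀ a b, dist (φ a) (φ b) ≤ dist a b) → (∀ a b, dist a b ≤ K * dist (φ a) (φ b) + K) →
      ∀ (n : ℕ) (f : ℕ → Y), IsIsometricPath n f →
        (∀ a b, a ≤ b → b ≤ n → ∀ w ∈ L (φ (f a)) (φ (f b)),
          ∃ t, a ≤ t ∧ t ≤ b ∧ dist w (φ (f t)) ≤ M) ∧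
        ∀ t ≤ n, ∃ w ∈ L (φ (f 0)) (φ (f n)), dist (φ (f t)) w ≤ M := by
  obtain ⟨M, hM⟩ := exists_stability h0 hL hL1 hK
  have hM0 : (0 : ℝ) ≤ M := Nat.cast_nonneg M
  refine ⟨K * (2 * M + 1) + K + M, by positivity, fun Y _ φ h1 h2 n f hf => ?_⟩
  have hM' : (M : ℝ) ≤ K * (2 * M + 1) + K + M := by
    have : 0 ≤ K * (2 * M + 1) + K := by positivity
    linarith
  have hch : ∀ i < n, dist (φ (f i)) (φ (f (i + 1))) ≤ 1 := fun i hi =>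
    (h1 _ _).trans (hf.dist_succ hi).le
  have hq : ∀ i j, i ≤ j → j ≤ n → (j : ℝ) - i ≤ K * dist (φ (f i)) (φ (f j)) + K := by
    intro i j hij hj
    rw [← hf.dist_eq hij hj]
    exact h2 _ _
  have key := hM (fun i => φ (f i)) n hch hq
  refine ⟨fun a b hab hb w hw => ?_, fun t ht => ?_⟩
  · obtain ⟨t, e1, e2, e3⟩ := key a b hab hb w hw
    exact ⟨t, e1, e2, e3.trans hM'⟩
  · obtain ⟨m, g, g0, gm, hg, hgL⟩ := hLc (φ (f 0)) (φ (f n))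
    refine exists_mem_dist_le_of_stability (f := fun i => φ (f i)) hK hM0 hch hq
      (fun w hw => ?_) g0 gm hg hgL ht
    obtain ⟨t, -, e2, e3⟩ := key 0 n (Nat.zero_le _) le_rfl w hw
    exact ⟨t, e2, e3⟩

/-- Move a point of one side to `L`, use slimness there, and return to another side; `h2` converts
the resulting estimate to the metric of `Y`. -/
theorem isHyperbolicSpace_of_stability {L : X → X → Set X} {h M K : ℝ} (hK : 0 ≤ K)
    (hL : ∀ x y z, ∀ w ∈ L x y, ∃ v ∈ L x z ∪ L z y, dist w v ≤ h)
    (hLs : ∀ x y, L x y ⊆ L y x) (hY : IsDiscretelyGeodesic Y) (φ : Y → X)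
    (h2 : ∀ a b, dist a b ≤ K * dist (φ a) (φ b) + K)
    (hM : ∀ (n : ℕ) (f : ℕ → Y), IsIsometricPath n f →
        (∀ a b, a ≤ b → b ≤ n → ∀ w ∈ L (φ (f a)) (φ (f b)),
          ∃ t, a ≤ t ∧ t ≤ b ∧ dist w (φ (f t)) ≤ M) ∧
        ∀ t ≤ n, ∃ w ∈ L (φ (f 0)) (φ (f n)), dist (φ (f t)) w ≤ M) :
    IsHyperbolicSpace (K * (M + h + M) + K) Y := by
  refine ⟨fun x y => ?_, fun x y z α β γ hα hβ hγ p hp => ?_⟩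
  · obtain ⟨n, f, h0, hn, hf⟩ := hY x y
    exact ⟨_, h0 ▸ hn ▸ IsIsometricPath.isGeodesic hf⟩
  · obtain ⟨n, f, f0, fn, hf, rfl⟩ := hY.exists_isometricPath hα
    obtain ⟨m, g, g0, gm, hg, rfl⟩ := hY.exists_isometricPath hβ
    obtain ⟨k, e, e0, ek, he, rfl⟩ := hY.exists_isometricPath hγ
    obtain ⟨t, ht, rfl⟩ := hp
    obtain ⟨w, hw, hwd⟩ := (hM n f hf).2 t ht.2
    rw [f0, fn] at hw
    obtain ⟨v, hv, hvd⟩ := hL _ _ (φ z) w hw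
    obtain ⟨q, hq, hqd⟩ : ∃ q ∈ g '' Set.Icc 0 m ∪ e '' Set.Icc 0 k, dist v (φ q) ≤ M := by
      rcases hv with hv | hv
      · rw [← e0, ← ek] at hv
        obtain ⟨s, -, hs, hd⟩ := (hM k e he).1 0 k (Nat.zero_le _) le_rfl v hv
        exact ⟨e s, Or.inr ⟨s, ⟨Nat.zero_le _, hs⟩, rfl⟩, hd⟩
      · have hv' := hLs _ _ hv
        rw [← g0, ← gm] at hv'
        obtain ⟨s, -, hs, hd⟩ := (hM m g hg).1 0 m (Nat.zero_le _) le_rfl v hv'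
        exact ⟨g s, Or.inl ⟨s, ⟨Nat.zero_le _, hs⟩, rfl⟩, hd⟩
    refine ⟨q, hq, (h2 _ _).trans ?_⟩
    have : dist (φ (f t)) (φ q) ≤ M + h + M := by
      linarith [dist_triangle4 (φ (f t)) w v (φ q)]
    gcongr

end Geodesics

/-! Families of quasiconvex sets with bounded coarse intersections -/

section Families

variable {X : Type u} [MetricSpace X] {I : Type v} {A : I → Set X} {C D δ R : ℝ}

theorem eq_of_nearOn (hX : IsDiscretelyGeodesic X) {ε : ℝ} (hε : 0 ≤ ε) (hR : 0 ≤ R)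
    (hsep : ∀ i j, i ≠ j → DiamLE (nbhd (2 * ε) (A i) ∩ A j) R) {i j : I} {x x' : X}
    {l u l' u' : ℝ} (hi : NearOn ε (A i) x x' l u) (hj : NearOn ε (A j) x x' l' u')
    (hl : 0 ≤ l) (hu : u ≤ 2 * dist x x')
    (h1 : 2 * (R + 2 * ε + 2) ≤ u - l) (h2 : 2 * (R + 2 * ε + 2) ≤ u' - l')
    (h3 : 2 * (R + 2 * ε + 2) ≤ u' - l) (h5 : 2 * (R + 2 * ε + 2) ≤ u - l') : i = j := by
  by_contra hne
  exact hi.exists_far_pair hX hj hl hu hε hR h1 h2 h3 h5 (hsep i j hne)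

/-- At most one member of the family is crossed at a given step of a path all of whose steps
are edges or have both end points in a member of the family. -/
theorem eq_of_crossing (hX : IsDiscretelyGeodesic X) (h4 : FourPoint δ X) (h0 : 0 ≤ δ)
    (hD : 0 ≤ D) (hR : 0 ≤ R) (hA : ∀ i, QuasiConvex D (A i)) (hC : ∀ i, EfficientProj C (A i))
    (hsep : ∀ i j, i ≠ j → DiamLE (nbhd (2 * (4 * δ + D)) (A i) ∩ A j) R) {S : ℝ}
    (hS : S = 2 * (R + 2 * (4 * δ + D) + 2) + δ) {x x' y y' w w' z z' : X} {i j : I}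
    (hy : y ∈ closestPts (A i) x) (hy' : y' ∈ closestPts (A i) x') (hyy : C + S ≤ dist y y')
    (hw : w ∈ closestPts (A j) x) (hw' : w' ∈ closestPts (A j) x') (hww : C + S ≤ dist w w')
    (hz : 2 * coord x x' z ≤ coord x x' y + coord x x' y')
    (hz' : coord x x' y + coord x x' y' ≤ 2 * coord x x' z')
    (hv : 2 * coord x x' z ≤ coord x x' w + coord x x' w')
    (hv' : coord x x' w + coord x x' w' ≤ 2 * coord x x' z')
    (hstep : dist z z' ≤ 1 ∨ ∃ k, z ∈ A k ∧ z' ∈ A k) : i = j := by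
  have hε : 0 ≤ 4 * δ + D := by positivity
  have e1 := (hC i).le_coord_sub hy hy'
  have e2 := (hC j).le_coord_sub hw hw'
  have hni := (hA i).nearOn h4 h0 hX (x := x) (x' := x') hy.1 hy'.1 (by linarith)
  have hnj := (hA j).nearOn h4 h0 hX (x := x) (x' := x') hw.1 hw'.1 (by linarith)
  -- Each range has half-length at least `S` about its midpoint. If the step moves by at most `S`,
  -- the midpoints are so close that the ranges overlap enough to force `i = j`. A longer step is
  -- not an edge, so it lies in some `A k`, whose range contains both midpoints and overlaps each of
  -- the two ranges.
  rcases le_or_gt (coord x x' z' - coord x x' z) S with hle | hlt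
  · exact eq_of_nearOn hX hε hR hsep hni hnj (coord_nonneg _ _ _) (coord_le _ _ _)
      (by linarith) (by linarith) (by linarith) (by linarith)
  · obtain hd | ⟨k, hzk, hzk'⟩ := hstep
    · linarith [coord_sub_le x x' z z']
    · have hnk := (hA k).nearOn h4 h0 hX (x := x) (x' := x') hzk hzk' (by linarith)
      have hik : i = k := eq_of_nearOn hX hε hR hsep hni hnk (coord_nonneg _ _ _)
        (coord_le _ _ _) (by linarith) (by linarith) (by linarith) (by linarith)
      have hjk : j = k := eq_of_nearOn hX hε hR hsep hnj hnk (coord_nonneg _ _ _)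
        (coord_le _ _ _) (by linarith) (by linarith) (by linarith) (by linarith)
      rw [hik, hjk]

/-- The number of members of the family on which the end points of a path have distant
projections is at most the number of steps of the path. -/
theorem exists_finset_far_projections (hX : IsDiscretelyGeodesic X) (h4 : FourPoint δ X)
    (h0 : 0 ≤ δ) (hD : 0 ≤ D) (hR : 0 ≤ R) (hA : ∀ i, QuasiConvex D (A i))
    (hC : ∀ i, EfficientProj C (A i))
    (hsep : ∀ i j, i ≠ j → DiamLE (nbhd (2 * (4 * δ + D)) (A i) ∩ A j) R) {S : ℝ}
    (hS : S = 2 * (R + 2 * (4 * δ + D) + 2) + δ) {f : ℕ → X} {n : ℕ}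
    (hf : ∀ k < n, dist (f k) (f (k + 1)) ≤ 1 ∨ ∃ i, f k ∈ A i ∧ f (k + 1) ∈ A i) :
    ∃ T : Finset I, T.card ≤ n ∧ ∀ i, i ∈ T ↔
      ∃ y ∈ closestPts (A i) (f 0), ∃ y' ∈ closestPts (A i) (f n), C + S ≤ dist y y' := by
  classical
  set P : Set I := {i | ∃ y ∈ closestPts (A i) (f 0), ∃ y' ∈ closestPts (A i) (f n),
    C + S ≤ dist y y'} with hP
  -- The path moves from position `0` to the maximal position `2 * dist (f 0) (f n)`, so some step
  -- crosses the midpoint of the range between the two projections.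
  have hcr : ∀ i : P, ∃ k : Fin n, ∃ y ∈ closestPts (A i) (f 0),
      ∃ y' ∈ closestPts (A i) (f n), C + S ≤ dist y y' ∧
        2 * coord (f 0) (f n) (f k) ≤ coord (f 0) (f n) y + coord (f 0) (f n) y' ∧
        coord (f 0) (f n) y + coord (f 0) (f n) y' ≤ 2 * coord (f 0) (f n) (f (k + 1)) := by
    rintro ⟨i, y, hy, y', hy', hyy⟩
    have e1 := (hC i).le_coord_sub hy hy'
    have e2 := coord_le (f 0) (f n) y'
    have e3 := coord_nonneg (f 0) (f n) y
    obtain ⟨k, hk, h1, h2⟩ := exists_step_of_not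
      (Q := fun k => 2 * coord (f 0) (f n) (f k) ≤ coord (f 0) (f n) y + coord (f 0) (f n) y')
      (n := n) (by rw [coord_left]; linarith [coord_nonneg (f 0) (f n) y'])
      (by rw [coord_right, not_le]; linarith)
    exact ⟨⟨k, hk⟩, y, hy, y', hy', hyy, h1, (not_le.1 h2).le⟩
  choose g hg using hcr
  have hinj : Function.Injective g := by
    intro i j hij
    obtain ⟨y, hy, y', hy', hyy, h1, h2⟩ := hg i
    obtain ⟨w, hw, w', hw', hww, h1', h2'⟩ := hg j
    rw [← hij] at h1' h2'
    exact Subtype.ext (eq_of_crossing hX h4 h0 hD hR hA hC hsep hS hy hy' hyy hw hw' hww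
      h1 h2 h1' h2' (hf _ (g i).2))
  have hfin : Finite P := Finite.of_injective g hinj
  have hPf : P.Finite := Set.toFinite P
  refine ⟨hPf.toFinset, ?_, fun i => by simp [hP]⟩
  rw [← Set.ncard_eq_toFinset_card P hPf, ← Nat.card_coe_set_eq]
  simpa using Nat.card_le_card_of_injective g hinj

/-- If the end points of a path with few steps are distant, then so are their projections to
some member of the family. -/
theorem exists_far_projections (hX : IsDiscretelyGeodesic X) (h4 : FourPoint δ X)
    (h0 : 0 ≤ δ) (hR : 0 ≤ R) (hA : ∀ i, QuasiConvex D (A i)) {S : ℝ}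
    (hS : S = 2 * (R + 2) + δ) {f : ℕ → X} {n : ℕ}
    (hf : ∀ k < n, dist (f k) (f (k + 1)) ≤ 1 ∨ ∃ i, f k ∈ A i ∧ f (k + 1) ∈ A i)
    (hn : n * S < 2 * dist (f 0) (f n)) :
    ∃ i, ∀ y ∈ closestPts (A i) (f 0), ∀ y' ∈ closestPts (A i) (f n),
      R - 2 * (4 * δ + D) < dist y y' := by
  -- The total change of position exceeds `n * S`, so one step gains more than `S`; an edge gains at
  -- most `2`.
  obtain ⟨k, hk, h1, h2⟩ := exists_step_of_not
    (Q := fun k => coord (f 0) (f n) (f k) ≤ k * S) (n := n) (by rw [coord_left]; simp)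
    (by rw [coord_right, not_le]; exact hn)
  push_cast at h2
  have hlt : S < coord (f 0) (f n) (f (k + 1)) - coord (f 0) (f n) (f k) := by linarith
  obtain hd | ⟨i, hi, hi'⟩ := hf k hk
  · linarith [coord_sub_le (f 0) (f n) (f k) (f (k + 1))]
  · refine ⟨i, fun y hy y' hy' => ?_⟩
    have hni := (hA i).nearOn h4 h0 hX (x := f 0) (x' := f n) hi hi' (by linarith)
    obtain ⟨p, hp, p', hp', e1, e2, e3, e4, e5, e6⟩ := hX.exists_pair (R := R)
      (coord_nonneg (f 0) (f n) (f k)) (coord_le (f 0) (f n) (f (k + 1))) hR (by linarith)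
    obtain ⟨a, ha, had⟩ := hni p hp e1 e2
    obtain ⟨b, hb, hbd⟩ := hni p' hp' e3 e4
    -- The distances from `f 0` and `f n` to their projections are at most those to `a` and `b`, so
    -- the triangle inequality forces the projections to be nearly as far apart as `p` and `p'`.
    have e7 := hy.2 a ha
    have e8 := hy'.2 b hb
    have e9 := dist_triangle (f 0) p a
    have e10 := dist_triangle (f n) p' b
    have e11 := dist_triangle4 (f 0) y y' (f n)
    simp only [interval, Set.mem_ofPred_eq] at hp'
    rw [dist_comm (f n) p'] at e10
    rw [dist_comm (f n) y'] at e8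
    linarith

end Families

/-! Graphs as discrete geodesic spaces -/

section VertexSpaces

theorem VertexSpace.dist_le_one_of_adj {V : Type u} {G : SimpleGraph V} {hG : G.Connected}
    {x y : VertexSpace G hG} (h : SimpleGraph.Adj (V := V) G x y) : dist x y ≤ 1 := by
  have : SimpleGraph.dist (V := V) G x y = 1 := SimpleGraph.dist_eq_one_iff_adj.2 h
  change ((SimpleGraph.dist (V := V) G x y : ℕ) : ℝ) ≤ 1
  rw [this, Nat.cast_one]

theorem VertexSpace.eq_or_adj_of_dist_le_one {V : Type u} {G : SimpleGraph V}
    {hG : G.Connected} {x y : VertexSpace G hG} (h : dist x y ≤ 1) :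
    x = y ∨ SimpleGraph.Adj (V := V) G x y := by
  change ((SimpleGraph.dist (V := V) G x y : ℕ) : ℝ) ≤ 1 at h
  have h' : SimpleGraph.dist (V := V) G x y ≤ 1 := by exact_mod_cast h
  rcases Nat.le_one_iff_eq_zero_or_eq_one.1 h' with h0 | h1
  · exact Or.inl (hG.dist_eq_zero_iff.1 h0)
  · exact Or.inr (SimpleGraph.dist_eq_one_iff_adj.1 h1)

theorem VertexSpace.isDiscretelyGeodesic {V : Type u} (G : SimpleGraph V) (hG : G.Connected) :
    IsDiscretelyGeodesic (VertexSpace G hG) := by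
  intro x y
  obtain ⟨p, hp⟩ := hG.exists_walk_length_eq_dist (show V from x) (show V from y)
  refine ⟨p.length, fun i => p.getVert i, p.getVert_zero, p.getVert_length, ?_⟩
  intro s hs t ht
  refine dist_eq_of_chain (X := VertexSpace G hG) (f := fun i => p.getVert i)
    (fun i hi => dist_le_one_of_adj (p.adj_getVert_succ hi)) ?_ hs ht
  refine (congrArg₂ (dist (α := VertexSpace G hG)) p.getVert_zero p.getVert_length).trans ?_
  rw [hp]
  rfl

theorem VertexSpace.dist_map_le {V : Type u} {G : SimpleGraph V} {hG : G.Connected}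
    {X : Type v} [MetricSpace X] {φ : VertexSpace G hG → X}
    (hφ : ∀ x y : VertexSpace G hG, SimpleGraph.Adj (V := V) G x y → dist (φ x) (φ y) ≤ 1)
    (x y : VertexSpace G hG) : dist (φ x) (φ y) ≤ dist x y := by
  obtain ⟨n, f, hd, f0, fn, hf, -⟩ := (isDiscretelyGeodesic G hG).exists_path x y
  have hf' : IsIsometricPath n f := hf
  have h := dist_le_of_chain (f := fun i => φ (f i)) (n := n) (fun i hi => ?_)
    (Nat.zero_le n) le_rfl
  · simpa [f0, fn, hd] using h
  · obtain heq | hadj := eq_or_adj_of_dist_le_one (hf'.dist_succ hi).le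
    · simp [← heq]
    · exact hφ _ _ hadj

end VertexSpaces

/-! Cone-offs of a hyperbolic graph -/

section ConeOffs

variable {V : Type u} {Γ : SimpleGraph V} (hΓ : Γ.Connected) (ℋ : Set Γ.Subgraph)
  (hconn : ∀ H ∈ ℋ, H.Connected)

/-- The index of the whole graph. -/
def topIndex : ↥(insert ⊤ ℋ : Set Γ.Subgraph) := ⟨⊤, Set.mem_insert _ _⟩

/-- The inclusion of the vertices of a cone-off into the ambient graph. -/
def coneIncl (W : ↥(insert ⊤ ℋ : Set Γ.Subgraph)) (a : ConeOffSpace hΓ ℋ hconn W) :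
    VertexSpace Γ hΓ :=
  (show W.1.verts from a).1

/-- A point of the ambient graph as a point of a cone-off. -/
def toCone (W : ↥(insert ⊤ ℋ : Set Γ.Subgraph)) (x : VertexSpace Γ hΓ)
    (hx : x ∈ pts Γ hΓ W.1) : ConeOffSpace hΓ ℋ hconn W :=
  (⟨x, hx⟩ : W.1.verts)

/-- A point of the ambient graph as a point of its cone-off. -/
def toTop (x : VertexSpace Γ hΓ) : ConeOffSpace hΓ ℋ hconn (topIndex ℋ) :=
  toCone hΓ ℋ hconn (topIndex ℋ) x trivial

variable {ℋ}

theorem mem_of_ne_topIndex {W : ↥(insert ⊤ ℋ : Set Γ.Subgraph)} (h : W ≠ topIndex ℋ) :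
    W.1 ∈ ℋ := by
  obtain ⟨W, rfl | hW⟩ := W
  · exact absurd rfl h
  · exact hW

theorem lt_top_of_ne_topIndex {W : ↥(insert ⊤ ℋ : Set Γ.Subgraph)} (h : W ≠ topIndex ℋ) :
    W.1 < ⊤ :=
  lt_top_iff_ne_top.2 fun hW => h (Subtype.ext hW)

variable {hΓ hconn}

theorem coneIncl_mem (W : ↥(insert ⊤ ℋ : Set Γ.Subgraph)) (a : ConeOffSpace hΓ ℋ hconn W) :
    coneIncl hΓ ℋ hconn W a ∈ pts Γ hΓ W.1 :=
  (show W.1.verts from a).2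

theorem coneIncl_toTop (x : VertexSpace Γ hΓ) :
    coneIncl hΓ ℋ hconn (topIndex ℋ) (toTop hΓ ℋ hconn x) = x := rfl

theorem toTop_coneIncl (a : ConeOffSpace hΓ ℋ hconn (topIndex ℋ)) :
    toTop hΓ ℋ hconn (coneIncl hΓ ℋ hconn (topIndex ℋ) a) = a := rfl

theorem dist_toTop_le (x y : VertexSpace Γ hΓ) :
    dist (toTop hΓ ℋ hconn x) (toTop hΓ ℋ hconn y) ≤ dist x y := by
  refine VertexSpace.dist_map_le (fun x y h => VertexSpace.dist_le_one_of_adj ?_) x y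
  exact Or.inl h

theorem dist_toTop_le_one {H : Γ.Subgraph} (hH : H ∈ ℋ) (hH' : H < ⊤) {x y : VertexSpace Γ hΓ}
    (hx : x ∈ pts Γ hΓ H) (hy : y ∈ pts Γ hΓ H) :
    dist (toTop hΓ ℋ hconn x) (toTop hΓ ℋ hconn y) ≤ 1 := by
  by_cases h : x = y
  · simp [h]
  · refine VertexSpace.dist_le_one_of_adj (Or.inr ?_)
    exact (SimpleGraph.fromRel_adj _ _ _).2
      ⟨fun he => h (congrArg Subtype.val he), Or.inl ⟨H, hH, hH', hx, hy⟩⟩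

theorem dist_le_one_or_of_dist_toTop {x y : VertexSpace Γ hΓ}
    (h : dist (toTop hΓ ℋ hconn x) (toTop hΓ ℋ hconn y) ≤ 1) :
    dist x y ≤ 1 ∨ ∃ W : ↥(insert ⊤ ℋ : Set Γ.Subgraph), W ≠ topIndex ℋ ∧
      x ∈ pts Γ hΓ W.1 ∧ y ∈ pts Γ hΓ W.1 := by
  obtain he | hadj | hadj := VertexSpace.eq_or_adj_of_dist_le_one h
  · have : x = y := congrArg (coneIncl hΓ ℋ hconn (topIndex ℋ)) he
    simp [this]
  · exact Or.inl (VertexSpace.dist_le_one_of_adj hadj)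
  · obtain ⟨-, ⟨H, hH, hlt, hx, hy⟩ | ⟨H, hH, hlt, hx, hy⟩⟩ :=
      (SimpleGraph.fromRel_adj _ _ _).1 hadj
    · exact Or.inr ⟨⟨H, Or.inr hH⟩, fun he => hlt.ne (congrArg Subtype.val he), hx, hy⟩
    · exact Or.inr ⟨⟨H, Or.inr hH⟩, fun he => hlt.ne (congrArg Subtype.val he), hy, hx⟩

/-- In an antichain this applies to every member, so only the cone-off of `Γ` can differ from the
original graph. -/
theorem coneOff_eq_coe {H : Γ.Subgraph} (h : ∀ H' ∈ ℋ, ¬ H' < H) : coneOff ℋ H = H.coe := by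
  ext x y
  simp only [coneOff, SimpleGraph.sup_adj, SimpleGraph.fromRel_adj]
  refine ⟨?_, Or.inl⟩
  rintro (h1 | ⟨-, ⟨H', hH', hlt, -⟩ | ⟨H', hH', hlt, -⟩⟩)
  · exact h1
  · exact absurd hlt (h H' hH')
  · exact absurd hlt (h H' hH')

theorem dist_coneOffSpace {W : ↥(insert ⊤ ℋ : Set Γ.Subgraph)} (hW : W.1 ∈ ℋ)
    (h : ∀ H' ∈ ℋ, ¬ H' < W.1) (a b : ConeOffSpace hΓ ℋ hconn W) :
    dist a b = dist (show VertexSpace W.1.coe (hconn W.1 hW).coe from a)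
      (show VertexSpace W.1.coe (hconn W.1 hW).coe from b) := by
  change ((SimpleGraph.dist (V := W.1.verts) (coneOff ℋ W.1) a b : ℕ) : ℝ) =
    ((SimpleGraph.dist (V := W.1.verts) W.1.coe a b : ℕ) : ℝ)
  rw [coneOff_eq_coe h]

theorem dist_coneIncl_le {W : ↥(insert ⊤ ℋ : Set Γ.Subgraph)} (hW : W.1 ∈ ℋ)
    (h : ∀ H' ∈ ℋ, ¬ H' < W.1) (a b : ConeOffSpace hΓ ℋ hconn W) :
    dist (coneIncl hΓ ℋ hconn W a) (coneIncl hΓ ℋ hconn W b) ≤ dist a b := by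
  rw [dist_coneOffSpace hW h]
  refine VertexSpace.dist_map_le (hG := (hconn W.1 hW).coe) (φ := coneIncl hΓ ℋ hconn W)
    (fun x y hxy => VertexSpace.dist_le_one_of_adj ?_) a b
  exact W.1.adj_sub hxy

theorem dist_le_of_isQIEmbedding {W : ↥(insert ⊤ ℋ : Set Γ.Subgraph)} (hW : W.1 ∈ ℋ)
    (h : ∀ H' ∈ ℋ, ¬ H' < W.1) {K : ℝ} (hK : 1 ≤ K)
    (hqi : IsQIEmbedding K (incl Γ hΓ W.1 (hconn W.1 hW))) (a b : ConeOffSpace hΓ ℋ hconn W) :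
    dist a b ≤ K ^ 2 * dist (coneIncl hΓ ℋ hconn W a) (coneIncl hΓ ℋ hconn W b) + K ^ 2 := by
  rw [dist_coneOffSpace hW h]
  have h1 := (hqi a b).1
  change _ ≤ dist (coneIncl hΓ ℋ hconn W a) (coneIncl hΓ ℋ hconn W b) at h1
  rw [sub_le_iff_le_add, div_le_iff₀ (by linarith)] at h1
  have h2 : 0 ≤ dist (coneIncl hΓ ℋ hconn W a) (coneIncl hΓ ℋ hconn W b) := dist_nonneg
  nlinarith [mul_nonneg (mul_nonneg (by linarith : 0 ≤ K) (sub_nonneg.2 hK)) h2]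

/-- The interval in the ambient graph, as a subset of the cone-off. -/
def coneInterval (a b : ConeOffSpace hΓ ℋ hconn (topIndex ℋ)) :
    Set (ConeOffSpace hΓ ℋ hconn (topIndex ℋ)) :=
  {c | coneIncl hΓ ℋ hconn _ c ∈ interval (coneIncl hΓ ℋ hconn _ a) (coneIncl hΓ ℋ hconn _ b)}

theorem coneInterval_symm {a b c : ConeOffSpace hΓ ℋ hconn (topIndex ℋ)}
    (h : c ∈ coneInterval a b) : c ∈ coneInterval b a :=
  interval_symm (X := VertexSpace Γ hΓ) h

theorem exists_path_interval {X : Type u} [MetricSpace X] (hX : IsDiscretelyGeodesic X)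
    (x y : X) : ∃ (m : ℕ) (g : ℕ → X), g 0 = x ∧ g m = y ∧
      (∀ i < m, dist (g i) (g (i + 1)) ≤ 1) ∧ ∀ i ≤ m, g i ∈ interval x y := by
  obtain ⟨m, g, -, g0, gm, hg, hgi⟩ := hX.exists_path x y
  exact ⟨m, g, g0, gm, fun i hi => (IsIsometricPath.dist_succ hg hi).le, fun i hi => (hgi i hi).1⟩

theorem interval_small {X : Type u} [MetricSpace X] {x y w : X} (h : dist x y ≤ 1)
    (hw : w ∈ interval x y) : dist w x ≤ 1 := by
  simp only [interval, Set.mem_ofPred_eq] at hw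
  rw [dist_comm]
  linarith [dist_nonneg (x := w) (y := y)]

/-- Members of a uniformly quasi-isometrically embedded family are uniformly quasiconvex and
hyperbolic. -/
theorem exists_quasiConvex_hyperbolic {h K : ℝ} (h1 : 1 ≤ h) (hK : 0 ≤ K)
    (hs : SlimIntervals h (VertexSpace Γ hΓ))
    (hle : ∀ W : ↥(insert ⊤ ℋ : Set Γ.Subgraph), W ≠ topIndex ℋ →
      ∀ a b : ConeOffSpace hΓ ℋ hconn W,
        dist (coneIncl hΓ ℋ hconn W a) (coneIncl hΓ ℋ hconn W b) ≤ dist a b)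
    (hqi : ∀ W : ↥(insert ⊤ ℋ : Set Γ.Subgraph), W ≠ topIndex ℋ →
      ∀ a b : ConeOffSpace hΓ ℋ hconn W,
        dist a b ≤ K * dist (coneIncl hΓ ℋ hconn W a) (coneIncl hΓ ℋ hconn W b) + K) :
    ∃ D δ : ℝ, 0 ≤ D ∧ 0 ≤ δ ∧ ∀ W : ↥(insert ⊤ ℋ : Set Γ.Subgraph), W ≠ topIndex ℋ →
      QuasiConvex D (pts Γ hΓ W.1) ∧ IsHyperbolicSpace δ (ConeOffSpace hΓ ℋ hconn W) := by
  obtain ⟨M, hM0, hM⟩ := exists_stability_isometricPath (by linarith) hs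
    (fun x y hxy w hw => (interval_small hxy hw).trans h1)
    (exists_path_interval (VertexSpace.isDiscretelyGeodesic Γ hΓ)) hK
  refine ⟨M, K * (M + h + M) + K, hM0, by positivity, fun W hW => ⟨?_, ?_⟩⟩
  · intro a ha b hb z hz
    obtain ⟨n, f, f0, fn, hf⟩ := VertexSpace.isDiscretelyGeodesic (coneOff ℋ W.1)
      (coneOff_connected ℋ W.1 (connected_insert_top hΓ ℋ hconn W))
      (toCone hΓ ℋ hconn W a ha) (toCone hΓ ℋ hconn W b hb)
    obtain ⟨t, -, -, hd⟩ := (hM _ _ (hle W hW) (hqi W hW) n f hf).1 0 n (Nat.zero_le _) le_rfl z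
      (by rw [f0, fn]; exact hz)
    exact ⟨_, coneIncl_mem W (f t), hd⟩
  · exact isHyperbolicSpace_of_stability hK hs (fun x y w hw => interval_symm hw)
      (VertexSpace.isDiscretelyGeodesic _ _) _ (hqi W hW) (hM _ _ (hle W hW) (hqi W hW))

/-- The cone-off of a hyperbolic graph with respect to uniformly quasiconvex subgraphs is
hyperbolic, and its geodesics are close to those of the graph. -/
theorem exists_cone_stability {h D : ℝ} (h0 : 0 ≤ h) (hD : 0 ≤ D)
    (hs : SlimIntervals h (VertexSpace Γ hΓ))
    (hQ : ∀ W : ↥(insert ⊤ ℋ : Set Γ.Subgraph), W ≠ topIndex ℋ →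
      QuasiConvex D (pts Γ hΓ W.1)) :
    ∃ M δ : ℝ, 0 ≤ M ∧ 0 ≤ δ ∧
      IsHyperbolicSpace δ (ConeOffSpace hΓ ℋ hconn (topIndex ℋ)) ∧
      ∀ (n : ℕ) (f : ℕ → ConeOffSpace hΓ ℋ hconn (topIndex ℋ)), IsIsometricPath n f →
        ∀ a b, a ≤ b → b ≤ n → ∀ w ∈ interval (coneIncl hΓ ℋ hconn _ (f a))
          (coneIncl hΓ ℋ hconn _ (f b)),
          ∃ t, a ≤ t ∧ t ≤ b ∧ dist (toTop hΓ ℋ hconn w) (f t) ≤ M := by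
  have hL : ∀ x y z : ConeOffSpace hΓ ℋ hconn (topIndex ℋ), ∀ w ∈ coneInterval x y,
      ∃ v ∈ coneInterval x z ∪ coneInterval z y, dist w v ≤ h + D + 1 := by
    intro x y z w hw
    obtain ⟨v, hv, hvd⟩ := hs _ _ (coneIncl hΓ ℋ hconn _ z) _ hw
    refine ⟨toTop hΓ ℋ hconn v, hv, ?_⟩
    have := dist_toTop_le (ℋ := ℋ) (hconn := hconn) (coneIncl hΓ ℋ hconn _ w) v
    rw [toTop_coneIncl] at this
    linarith
  -- For a cone edge inside `W`, quasiconvexity keeps the interval of `Γ` near `W`, which has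
  -- diameter at most `1` in the cone-off.
  have hL1 : ∀ x y : ConeOffSpace hΓ ℋ hconn (topIndex ℋ), dist x y ≤ 1 →
      ∀ w ∈ coneInterval x y, dist w x ≤ h + D + 1 := by
    intro x y hxy w hw
    obtain hd | ⟨W, hW, hx, hy⟩ := dist_le_one_or_of_dist_toTop (x := coneIncl hΓ ℋ hconn _ x)
      (y := coneIncl hΓ ℋ hconn _ y) hxy
    · have h1 := dist_toTop_le (ℋ := ℋ) (hconn := hconn) (coneIncl hΓ ℋ hconn _ w)
        (coneIncl hΓ ℋ hconn _ x)
      have h2 := interval_small hd hw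
      rw [toTop_coneIncl, toTop_coneIncl] at h1
      linarith
    · obtain ⟨v, hv, hvd⟩ := hQ W hW _ hx _ hy _ hw
      have h1 := dist_toTop_le (ℋ := ℋ) (hconn := hconn) (coneIncl hΓ ℋ hconn _ w) v
      have h2 := dist_toTop_le_one (hconn := hconn) (mem_of_ne_topIndex hW)
        (lt_top_of_ne_topIndex hW) hv hx
      rw [toTop_coneIncl] at h1 h2
      linarith [dist_triangle w (toTop hΓ ℋ hconn v) x]
  have hLc : ∀ x y : ConeOffSpace hΓ ℋ hconn (topIndex ℋ), ∃ (m : ℕ) (g : ℕ → _), g 0 = x ∧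
      g m = y ∧ (∀ i < m, dist (g i) (g (i + 1)) ≤ 1) ∧ ∀ i ≤ m, g i ∈ coneInterval x y := by
    intro x y
    obtain ⟨m, g, g0, gm, hg, hgi⟩ := exists_path_interval
      (VertexSpace.isDiscretelyGeodesic Γ hΓ) (coneIncl hΓ ℋ hconn _ x) (coneIncl hΓ ℋ hconn _ y)
    refine ⟨m, fun i => toTop hΓ ℋ hconn (g i), ?_, ?_, fun i hi => ?_, hgi⟩
    · exact congrArg (toTop hΓ ℋ hconn) g0
    · exact congrArg (toTop hΓ ℋ hconn) gm
    · exact (dist_toTop_le _ _).trans (hg i hi)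
  -- The geodesics considered are those of the cone-off itself, so the comparison map is the
  -- identity and `K = 1`.
  obtain ⟨M, hM0, hM⟩ := exists_stability_isometricPath (L := coneInterval)
    (h := h + D + 1) (by linarith) hL hL1 hLc (zero_le_one (α := ℝ))
  have hM' := hM (ConeOffSpace hΓ ℋ hconn (topIndex ℋ)) id (fun _ _ => le_rfl)
    (fun a b => by rw [id, id]; linarith)
  refine ⟨M, 1 * (M + (h + D + 1) + M) + 1, hM0, by positivity, ?_, ?_⟩
  · exact isHyperbolicSpace_of_stability (zero_le_one (α := ℝ)) hL
      (fun x y w hw => coneInterval_symm hw) (VertexSpace.isDiscretelyGeodesic _ _) id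
      (fun a b => by rw [id, id]; linarith) hM'
  · intro n f hf a b hab hb w hw
    exact (hM' n f hf).1 a b hab hb (toTop hΓ ℋ hconn w) hw

end ConeOffs

/-! ### Distances between sets, and graphs as quasigeodesic spaces. -/

section SetDist

variable {M : Type u} [MetricSpace M]

theorem setDist_le_dist {A B : Set M} {a b : M} (ha : a ∈ A) (hb : b ∈ B) :
    setDist A B ≤ dist a b := by
  refine csInf_le ⟨0, ?_⟩ ⟨a, ha, b, hb, rfl⟩
  rintro _ ⟨a, -, b, -, rfl⟩
  exact dist_nonneg

theorem setDist_le_zero {A B : Set M} {a : M} (ha : a ∈ A) (hb : a ∈ B) : setDist A B ≤ 0 :=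
  (setDist_le_dist ha hb).trans (dist_self a).le

theorem exists_dist_lt_of_setDist_lt {A B : Set M} (hA : A.Nonempty) (hB : B.Nonempty) {r : ℝ}
    (h : setDist A B < r) : ∃ a ∈ A, ∃ b ∈ B, dist a b < r := by
  obtain ⟨_, ⟨a, ha, b, hb, rfl⟩, hlt⟩ := exists_lt_of_csInf_lt (hA.image2 hB) h
  exact ⟨a, ha, b, hb, hlt⟩

/-- Precomposing a discrete geodesic with the floor function changes distances by at most `1`. -/
theorem IsDiscretelyGeodesic.isQuasigeodesicSpace (hM : IsDiscretelyGeodesic M) :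
    IsQuasigeodesicSpace 2 M := by
  refine ⟨by norm_num, fun x y => ?_⟩
  obtain ⟨n, f, h0, hn, hf⟩ := hM x y
  refine ⟨n, fun s => f ⌊s⌋₊, n.cast_nonneg, by simpa using h0, by simpa using hn, ?_⟩
  intro s hs t ht
  rw [hf _ (Nat.floor_le_of_le hs.2) _ (Nat.floor_le_of_le ht.2)]
  have h1 := Nat.floor_le hs.1
  have h2 := Nat.lt_floor_add_one s
  have h3 := Nat.floor_le ht.1
  have h4 := Nat.lt_floor_add_one t
  have h5 : |s - t| ≤ |(⌊s⌋₊ : ℝ) - ⌊t⌋₊| + 1 := by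
    refine abs_le.2 ⟨?_, ?_⟩ <;> linarith [neg_abs_le ((⌊s⌋₊ : ℝ) - ⌊t⌋₊),
      le_abs_self ((⌊s⌋₊ : ℝ) - ⌊t⌋₊)]
  have h6 : |(⌊s⌋₊ : ℝ) - ⌊t⌋₊| ≤ |s - t| + 1 := by
    refine abs_le.2 ⟨?_, ?_⟩ <;> linarith [neg_abs_le (s - t), le_abs_self (s - t)]
  have h7 := abs_nonneg (s - t)
  constructor <;> linarith

end SetDist

/-! ### Projections to cone-offs and the data of the coarse geometry. -/

section HHS

variable {V : Type u} {Γ : SimpleGraph V} {hΓ : Γ.Connected} {ℋ : Set Γ.Subgraph}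
  {hconn : ∀ H ∈ ℋ, H.Connected}

/-- The projection of (the vertices of) `U` to `W`, as a subset of the cone-off of `W`. -/
def coneRho (hΓ : Γ.Connected) (ℋ : Set Γ.Subgraph) (hconn : ∀ H ∈ ℋ, H.Connected)
    (U W : ↥(insert ⊤ ℋ : Set Γ.Subgraph)) : Set (ConeOffSpace hΓ ℋ hconn W) :=
  {a | coneIncl hΓ ℋ hconn W a ∈ projSet (pts Γ hΓ W.1) (pts Γ hΓ U.1)}

theorem mem_coneRho {U W : ↥(insert ⊤ ℋ : Set Γ.Subgraph)} {a : ConeOffSpace hΓ ℋ hconn W} :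
    a ∈ coneRho hΓ ℋ hconn U W ↔
      ∃ x ∈ pts Γ hΓ U.1, coneIncl hΓ ℋ hconn W a ∈ closestPts (pts Γ hΓ W.1) x := by
  simp [coneRho, projSet]

theorem mem_closestPts_self {M : Type u} [MetricSpace M] {A : Set M} {x : M} (hx : x ∈ A) :
    x ∈ closestPts A x :=
  ⟨hx, fun b _ => by rw [dist_self]; exact dist_nonneg⟩

theorem eq_of_mem_closestPts {M : Type u} [MetricSpace M] {A : Set M} {x y : M} (hx : x ∈ A)
    (hy : y ∈ closestPts A x) : y = x := by
  have := hy.2 x hx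
  rw [dist_self] at this
  exact (dist_le_zero.1 this).symm

theorem pts_nonempty (W : ↥(insert ⊤ ℋ : Set Γ.Subgraph))
    (hconn : ∀ H ∈ ℋ, H.Connected) : (pts Γ hΓ W.1).Nonempty :=
  (connected_insert_top hΓ ℋ hconn W).nonempty

theorem coneOffProj_nonempty (W : ↥(insert ⊤ ℋ : Set Γ.Subgraph)) (x : VertexSpace Γ hΓ) :
    (coneOffProj hΓ ℋ hconn W x).Nonempty := by
  obtain ⟨y, hy⟩ := (VertexSpace.isDiscretelyGeodesic Γ hΓ).closestPts_nonempty
    (pts_nonempty W hconn) x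
  exact ⟨toCone hΓ ℋ hconn W y hy.1, hy⟩

theorem coneOffProj_subset_coneRho {U W : ↥(insert ⊤ ℋ : Set Γ.Subgraph)}
    {x : VertexSpace Γ hΓ} (hx : x ∈ pts Γ hΓ U.1) :
    coneOffProj hΓ ℋ hconn W x ⊆ coneRho hΓ ℋ hconn U W :=
  fun _ ha => mem_coneRho.2 ⟨x, hx, ha⟩

theorem coneRho_nonempty (U W : ↥(insert ⊤ ℋ : Set Γ.Subgraph)) :
    (coneRho hΓ ℋ hconn U W).Nonempty := by
  obtain ⟨x, hx⟩ := pts_nonempty (hΓ := hΓ) U hconn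
  exact (coneOffProj_nonempty W x).mono (coneOffProj_subset_coneRho hx)

theorem eq_toTop_of_mem_coneOffProj {x : VertexSpace Γ hΓ}
    {a : ConeOffSpace hΓ ℋ hconn (topIndex ℋ)} (ha : a ∈ coneOffProj hΓ ℋ hconn _ x) :
    a = toTop hΓ ℋ hconn x :=
  congrArg (toTop hΓ ℋ hconn) (eq_of_mem_closestPts (A := pts Γ hΓ (topIndex ℋ).1) trivial ha)

theorem coneOffProj_topIndex (x : VertexSpace Γ hΓ) :
    coneOffProj hΓ ℋ hconn (topIndex ℋ) x = {toTop hΓ ℋ hconn x} := by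
  refine Set.eq_singleton_iff_unique_mem.2 ⟨?_, fun a ha => eq_toTop_of_mem_coneOffProj ha⟩
  exact mem_closestPts_self (A := pts Γ hΓ (topIndex ℋ).1) trivial

theorem setDist_coneOffProj_topIndex (x y : VertexSpace Γ hΓ) :
    setDist (coneOffProj hΓ ℋ hconn (topIndex ℋ) x) (coneOffProj hΓ ℋ hconn (topIndex ℋ) y) =
      dist (toTop hΓ ℋ hconn x) (toTop hΓ ℋ hconn y) := by
  simp [coneOffProj_topIndex, setDist]

theorem toTop_mem_coneRho {U : ↥(insert ⊤ ℋ : Set Γ.Subgraph)} {x : VertexSpace Γ hΓ}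
    (hx : x ∈ pts Γ hΓ U.1) : toTop hΓ ℋ hconn x ∈ coneRho hΓ ℋ hconn U (topIndex ℋ) :=
  coneOffProj_subset_coneRho hx (by rw [coneOffProj_topIndex]; rfl)

theorem mem_pts_of_mem_coneRho_topIndex {U : ↥(insert ⊤ ℋ : Set Γ.Subgraph)}
    {a : ConeOffSpace hΓ ℋ hconn (topIndex ℋ)} (ha : a ∈ coneRho hΓ ℋ hconn U (topIndex ℋ)) :
    coneIncl hΓ ℋ hconn _ a ∈ pts Γ hΓ U.1 := by
  obtain ⟨x, hx, hax⟩ := mem_coneRho.1 ha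
  rwa [eq_of_mem_closestPts (A := pts Γ hΓ (topIndex ℋ).1) trivial hax]

/-- The coarse geometry of the pair `(Γ, ℋ)` with its constants. -/
structure ConeOffGeometry (hΓ : Γ.Connected) (ℋ : Set Γ.Subgraph)
    (hconn : ∀ H ∈ ℋ, H.Connected) (δ D C K M ξ δ' : ℝ) (R : ℝ → ℝ) : Prop where
  δ_nonneg : 0 ≤ δ
  D_nonneg : 0 ≤ D
  C_nonneg : 0 ≤ C
  one_le_K : 1 ≤ K
  M_nonneg : 0 ≤ M
  ξ_nonneg : 0 ≤ ξ
  δ'_nonneg : 0 ≤ δ'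
  R_nonneg : ∀ ε, 0 ≤ R ε
  fourPoint : FourPoint δ (VertexSpace Γ hΓ)
  quasiConvex : ∀ W : ↥(insert ⊤ ℋ : Set Γ.Subgraph), QuasiConvex D (pts Γ hΓ W.1)
  efficientProj : ∀ W : ↥(insert ⊤ ℋ : Set Γ.Subgraph), EfficientProj C (pts Γ hΓ W.1)
  dist_le : ∀ (W : ↥(insert ⊤ ℋ : Set Γ.Subgraph)) (a b : ConeOffSpace hΓ ℋ hconn W),
    dist a b ≤ K * dist (coneIncl hΓ ℋ hconn W a) (coneIncl hΓ ℋ hconn W b) + K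
  le_dist : ∀ W : ↥(insert ⊤ ℋ : Set Γ.Subgraph), W ≠ topIndex ℋ →
    ∀ a b : ConeOffSpace hΓ ℋ hconn W,
      dist (coneIncl hΓ ℋ hconn W a) (coneIncl hΓ ℋ hconn W b) ≤ dist a b
  diam_proj : ∀ U W : ↥(insert ⊤ ℋ : Set Γ.Subgraph), U ≠ topIndex ℋ → W ≠ topIndex ℋ →
    U ≠ W → DiamLE (projSet (pts Γ hΓ W.1) (pts Γ hΓ U.1)) ξ
  separated : ∀ (ε : ℝ) (U W : ↥(insert ⊤ ℋ : Set Γ.Subgraph)), U ≠ topIndex ℋ →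
    W ≠ topIndex ℋ → U ≠ W → DiamLE (nbhd ε (pts Γ hΓ U.1) ∩ pts Γ hΓ W.1) (R ε)
  stability : ∀ (n : ℕ) (f : ℕ → ConeOffSpace hΓ ℋ hconn (topIndex ℋ)), IsIsometricPath n f →
    ∀ a b, a ≤ b → b ≤ n → ∀ w ∈ interval (coneIncl hΓ ℋ hconn _ (f a))
      (coneIncl hΓ ℋ hconn _ (f b)), ∃ t, a ≤ t ∧ t ≤ b ∧ dist (toTop hΓ ℋ hconn w) (f t) ≤ M
  hyperbolic : ∀ W : ↥(insert ⊤ ℋ : Set Γ.Subgraph),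
    IsHyperbolicSpace δ' (ConeOffSpace hΓ ℋ hconn W)
  eq_topIndex : ∀ U W : ↥(insert ⊤ ℋ : Set Γ.Subgraph), U.1 ≤ W.1 → U ≠ W → W = topIndex ℋ

end HHS
-- Consistency, bounded geodesic image, large links and uniqueness.
section HHS

variable {V : Type u} {Γ : SimpleGraph V} {hΓ : Γ.Connected} {ℋ : Set Γ.Subgraph}
  {hconn : ∀ H ∈ ℋ, H.Connected}

namespace ConeOffGeometry

variable {δ D C K M ξ δ' : ℝ} {R : ℝ → ℝ}

theorem dist_le_of_le (h : ConeOffGeometry hΓ ℋ hconn δ D C K M ξ δ' R)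
    (W : ↥(insert ⊤ ℋ : Set Γ.Subgraph)) {a b : ConeOffSpace hΓ ℋ hconn W}
    {r : ℝ} (hr : dist (coneIncl hΓ ℋ hconn W a) (coneIncl hΓ ℋ hconn W b) ≤ r) :
    dist a b ≤ K * r + K := by
  have h1 := h.dist_le W a b
  have h2 := mul_le_mul_of_nonneg_left hr (zero_le_one.trans h.one_le_K)
  linarith

theorem proj_diam (h : ConeOffGeometry hΓ ℋ hconn δ D C K M ξ δ' R)
    (W : ↥(insert ⊤ ℋ : Set Γ.Subgraph)) (x : VertexSpace Γ hΓ) :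
    DiamLE (coneOffProj hΓ ℋ hconn W x) (K * C + K) := fun _ ha _ hb =>
  h.dist_le_of_le W ((h.efficientProj W).dist_le ha hb)

theorem proj_lipschitz (h : ConeOffGeometry hΓ ℋ hconn δ D C K M ξ δ' R)
    (W : ↥(insert ⊤ ℋ : Set Γ.Subgraph)) (x y : VertexSpace Γ hΓ) :
    setDist (coneOffProj hΓ ℋ hconn W x) (coneOffProj hΓ ℋ hconn W y) ≤
      (K * (C + 1)) * dist x y + K * (C + 1) := by
  obtain ⟨a, ha⟩ := coneOffProj_nonempty (hconn := hconn) W x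
  obtain ⟨b, hb⟩ := coneOffProj_nonempty (hconn := hconn) W y
  refine (setDist_le_dist ha hb).trans ((h.dist_le_of_le W
    ((h.efficientProj W).dist_le_dist_add ha hb)).trans ?_)
  have : 0 ≤ K * C * dist x y :=
    mul_nonneg (mul_nonneg (zero_le_one.trans h.one_le_K) h.C_nonneg) dist_nonneg
  linarith

theorem rho_diam_topIndex {U : ↥(insert ⊤ ℋ : Set Γ.Subgraph)} (hU : U ≠ topIndex ℋ) :
    DiamLE (coneRho hΓ ℋ hconn U (topIndex ℋ)) 1 := fun _ ha _ hb =>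
  dist_toTop_le_one (mem_of_ne_topIndex hU) (lt_top_of_ne_topIndex hU)
    (mem_pts_of_mem_coneRho_topIndex ha) (mem_pts_of_mem_coneRho_topIndex hb)

theorem rho_diam (h : ConeOffGeometry hΓ ℋ hconn δ D C K M ξ δ' R)
    {U W : ↥(insert ⊤ ℋ : Set Γ.Subgraph)} (hU : U ≠ topIndex ℋ) (hW : W ≠ topIndex ℋ)
    (hUW : U ≠ W) : DiamLE (coneRho hΓ ℋ hconn U W) (K * ξ + K) := fun _ ha _ hb =>
  h.dist_le_of_le W (h.diam_proj U W hU hW hUW _ ha _ hb)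

theorem consistency (h : ConeOffGeometry hΓ ℋ hconn δ D C K M ξ δ' R)
    (U W : ↥(insert ⊤ ℋ : Set Γ.Subgraph)) (x : VertexSpace Γ hΓ) :
    min (setDist (coneOffProj hΓ ℋ hconn W x) (coneRho hΓ ℋ hconn U W))
      (setDist (coneOffProj hΓ ℋ hconn U x) (coneRho hΓ ℋ hconn W U)) ≤
        K * (3 * C + δ) + K := by
  obtain ⟨v, hv⟩ := coneOffProj_nonempty (hconn := hconn) U x
  obtain ⟨w, hw⟩ := coneOffProj_nonempty (hconn := hconn) W x
  obtain ⟨w', hw'⟩ := coneOffProj_nonempty (hconn := hconn) W (coneIncl hΓ ℋ hconn U v)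
  obtain ⟨u, hu⟩ := coneOffProj_nonempty (hconn := hconn) U (coneIncl hΓ ℋ hconn W w')
  rcases le_or_gt (dist (coneIncl hΓ ℋ hconn W w) (coneIncl hΓ ℋ hconn W w')) (C + δ)
    with hle | hlt
  · refine (min_le_left _ _).trans ((setDist_le_dist hw
      (coneOffProj_subset_coneRho (coneIncl_mem U v) hw')).trans (h.dist_le_of_le W ?_))
    linarith [h.C_nonneg]
  · refine (min_le_right _ _).trans ((setDist_le_dist hv
      (coneOffProj_subset_coneRho (coneIncl_mem W w') hu)).trans (h.dist_le_of_le U ?_))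
    exact (h.efficientProj U).dist_le_of_contracting (h.efficientProj W) h.fourPoint h.δ_nonneg
      hv hw hw' hu hlt

theorem consistency_topIndex (h : ConeOffGeometry hΓ ℋ hconn δ D C K M ξ δ' R)
    (U : ↥(insert ⊤ ℋ : Set Γ.Subgraph)) (x : VertexSpace Γ hΓ) :
    DiamLE (coneOffProj hΓ ℋ hconn U x ∪ ⋃ p ∈ coneOffProj hΓ ℋ hconn (topIndex ℋ) x,
      coneOffProj hΓ ℋ hconn U (coneIncl hΓ ℋ hconn _ p)) (K * C + K) := by
  -- The projection of `x` to the cone-off of `Γ` is `x` itself, so the second term of the union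
  -- equals the first.
  have : coneOffProj hΓ ℋ hconn U x ∪ (⋃ p ∈ coneOffProj hΓ ℋ hconn (topIndex ℋ) x,
      coneOffProj hΓ ℋ hconn U (coneIncl hΓ ℋ hconn _ p)) = coneOffProj hΓ ℋ hconn U x := by
    rw [coneOffProj_topIndex, Set.biUnion_singleton, coneIncl_toTop, Set.union_self]
  rw [this]
  exact h.proj_diam U x

/-- Points with distant projections to a member of the family: geodesics of the cone-off joining
them pass close to the projections. -/
theorem exists_near_of_far (h : ConeOffGeometry hΓ ℋ hconn δ D C K M ξ δ' R)
    {U : ↥(insert ⊤ ℋ : Set Γ.Subgraph)} {x x' y y' : VertexSpace Γ hΓ}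
    (hy : y ∈ closestPts (pts Γ hΓ U.1) x) (hy' : y' ∈ closestPts (pts Γ hΓ U.1) x')
    (hyy : C + δ < dist y y') {n : ℕ} {f : ℕ → ConeOffSpace hΓ ℋ hconn (topIndex ℋ)}
    (hf : IsIsometricPath n f) {a b : ℕ} (hab : a ≤ b) (hb : b ≤ n)
    (hx : toTop hΓ ℋ hconn x = f a) (hx' : toTop hΓ ℋ hconn x' = f b) :
    ∃ t, a ≤ t ∧ t ≤ b ∧ dist (f t) (toTop hΓ ℋ hconn y) ≤ 2 * C + 2 * δ + M := by
  have h1 := (h.efficientProj U).contracting h.fourPoint h.δ_nonneg hy hy' hyy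
  have h2 := dist_triangle y y' x'
  obtain ⟨z, hz, hzd⟩ := h.fourPoint.exists_interval_near h.δ_nonneg
    (VertexSpace.isDiscretelyGeodesic Γ hΓ)
    (show dist x y + dist y x' ≤ dist x x' + (2 * C + δ) by linarith)
  obtain ⟨t, hat, htb, htd⟩ := h.stability n f hf a b hab hb z (by rw [← hx, ← hx']; exact hz)
  refine ⟨t, hat, htb, ?_⟩
  have h3 := dist_toTop_le (ℋ := ℋ) (hconn := hconn) y z
  have h4 := dist_triangle_left (f t) (toTop hΓ ℋ hconn y) (toTop hΓ ℋ hconn z)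
  rw [dist_comm (toTop hΓ ℋ hconn z) (toTop hΓ ℋ hconn y)] at h4
  linarith

/-- If two points of the geodesic project far apart on `U`, the segment between them must pass near
a projection, which lies in `U`. -/
theorem bounded_geodesic_image (h : ConeOffGeometry hΓ ℋ hconn δ D C K M ξ δ' R)
    (U : ↥(insert ⊤ ℋ : Set Γ.Subgraph)) {a b : ConeOffSpace hΓ ℋ hconn (topIndex ℋ)}
    {γ : Set (ConeOffSpace hΓ ℋ hconn (topIndex ℋ))} (hγ : IsGeodesic γ a b) {E : ℝ}
    (hE : K * (C + δ) + K ≤ E) (hE' : 2 * C + 2 * δ + M ≤ E) :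
    DiamLE (⋃ p ∈ γ, coneOffProj hΓ ℋ hconn U (coneIncl hΓ ℋ hconn _ p)) E ∨
      (γ ∩ nbhd E (coneRho hΓ ℋ hconn U (topIndex ℋ))).Nonempty := by
  obtain ⟨n, f, -, -, hf, rfl⟩ := (VertexSpace.isDiscretelyGeodesic _ _).exists_isometricPath hγ
  refine or_iff_not_imp_right.2 fun hempty u hu w hw => ?_
  simp only [Set.mem_iUnion₂] at hu hw
  obtain ⟨_, ⟨s, hs, rfl⟩, hu⟩ := hu
  obtain ⟨_, ⟨t, ht, rfl⟩, hw⟩ := hw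
  refine (h.dist_le_of_le U ?_).trans hE
  by_contra! hlt
  rcases le_total s t with hst | hts
  · obtain ⟨r, -, hr, hd⟩ := h.exists_near_of_far hu hw hlt hf hst ht.2 rfl rfl
    exact hempty ⟨f r, ⟨r, ⟨Nat.zero_le _, hr.trans ht.2⟩, rfl⟩, _,
      toTop_mem_coneRho (coneIncl_mem U u), hd.trans hE'⟩
  · rw [dist_comm] at hlt
    obtain ⟨r, -, hr, hd⟩ := h.exists_near_of_far hw hu hlt hf hts hs.2 rfl rfl
    exact hempty ⟨f r, ⟨r, ⟨Nat.zero_le _, hr.trans hs.2⟩, rfl⟩, _,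
      toTop_mem_coneRho (coneIncl_mem U w), hd.trans hE'⟩

theorem exists_conePath (x x' : VertexSpace Γ hΓ) :
    ∃ (n : ℕ) (f : ℕ → ConeOffSpace hΓ ℋ hconn (topIndex ℋ)),
      dist (toTop hΓ ℋ hconn x) (toTop hΓ ℋ hconn x') = n ∧ f 0 = toTop hΓ ℋ hconn x ∧
      f n = toTop hΓ ℋ hconn x' ∧ IsIsometricPath n f ∧
      ∀ k < n, dist (coneIncl hΓ ℋ hconn _ (f k)) (coneIncl hΓ ℋ hconn _ (f (k + 1))) ≤ 1 ∨
        ∃ U : {U : ↥(insert ⊤ ℋ : Set Γ.Subgraph) // U ≠ topIndex ℋ},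
          coneIncl hΓ ℋ hconn _ (f k) ∈ pts Γ hΓ U.1.1 ∧
          coneIncl hΓ ℋ hconn _ (f (k + 1)) ∈ pts Γ hΓ U.1.1 := by
  obtain ⟨n, f, hd, f0, fn, hf, -⟩ := (VertexSpace.isDiscretelyGeodesic (coneOff ℋ ⊤)
    (coneOff_connected ℋ _ (connected_insert_top hΓ ℋ hconn (topIndex ℋ)))).exists_path
      (toTop hΓ ℋ hconn x) (toTop hΓ ℋ hconn x')
  refine ⟨n, f, hd, f0, fn, hf, fun k hk => ?_⟩
  obtain h1 | ⟨W, hW, h1, h2⟩ := dist_le_one_or_of_dist_toTop (hconn := hconn)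
    (x := coneIncl hΓ ℋ hconn (topIndex ℋ) (f k))
    (y := coneIncl hΓ ℋ hconn (topIndex ℋ) (f (k + 1))) (IsIsometricPath.dist_succ hf hk).le
  · exact Or.inl h1
  · exact Or.inr ⟨⟨W, hW⟩, h1, h2⟩

theorem large_links (h : ConeOffGeometry hΓ ℋ hconn δ D C K M ξ δ' R) {S : ℝ}
    (hS : S = 2 * (R (2 * (4 * δ + D)) + 2 * (4 * δ + D) + 2) + δ) (x x' : VertexSpace Γ hΓ) :
    ∃ T : Finset ↥(insert ⊤ ℋ : Set Γ.Subgraph),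
      (T.card : ℝ) ≤ dist (toTop hΓ ℋ hconn x) (toTop hΓ ℋ hconn x') ∧
      (∀ U ∈ T, U ≠ topIndex ℋ ∧
        setDist (coneOffProj hΓ ℋ hconn (topIndex ℋ) x) (coneRho hΓ ℋ hconn U (topIndex ℋ)) ≤
          dist (toTop hΓ ℋ hconn x) (toTop hΓ ℋ hconn x') + (2 * C + 2 * δ + M)) ∧
      ∀ U, U ≠ topIndex ℋ → U ∉ T →
        setDist (coneOffProj hΓ ℋ hconn U x) (coneOffProj hΓ ℋ hconn U x') ≤
          K * (C + S) + K := by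
  have hD := h.D_nonneg
  have hδ := h.δ_nonneg
  have hR := h.R_nonneg (2 * (4 * δ + D))
  obtain ⟨n, f, hd, f0, fn, hf, hstep⟩ := exists_conePath (ℋ := ℋ) (hconn := hconn) x x'
  obtain ⟨T, hTn, hT⟩ := exists_finset_far_projections
    (A := fun U : {U : ↥(insert ⊤ ℋ : Set Γ.Subgraph) // U ≠ topIndex ℋ} => pts Γ hΓ U.1.1)
    (f := fun k => coneIncl hΓ ℋ hconn _ (f k)) (VertexSpace.isDiscretelyGeodesic Γ hΓ)
    h.fourPoint h.δ_nonneg h.D_nonneg hR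
    (fun U => h.quasiConvex U.1) (fun U => h.efficientProj U.1)
    (fun U W hUW => h.separated _ U.1 W.1 U.2 W.2 fun he => hUW (Subtype.ext he)) hS hstep
  simp only [f0, fn, coneIncl_toTop] at hT
  refine ⟨T.map (Function.Embedding.subtype _), ?_, ?_, ?_⟩
  · rw [Finset.card_map, hd]
    exact_mod_cast hTn
  · intro U hU
    simp only [Finset.mem_map, Function.Embedding.subtype_apply] at hU
    obtain ⟨⟨U, hU'⟩, hUT, rfl⟩ := hU
    obtain ⟨y, hy, y', hy', hyy⟩ := (hT _).1 hUT
    refine ⟨hU', ?_⟩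
    obtain ⟨t, -, ht, htd⟩ := h.exists_near_of_far hy hy' (by linarith) hf (Nat.zero_le n)
      le_rfl f0.symm fn.symm
    rw [coneOffProj_topIndex]
    refine (setDist_le_dist (Set.mem_singleton _) (toTop_mem_coneRho hy.1)).trans ?_
    have h1 := hf.dist_eq (Nat.zero_le t) ht
    have h2 : (t : ℝ) ≤ n := by exact_mod_cast ht
    have h3 := dist_triangle (f 0) (f t) (toTop hΓ ℋ hconn y)
    rw [hd, ← f0]
    push_cast at h1
    linarith
  · intro U hU hUT
    obtain ⟨a, ha⟩ := coneOffProj_nonempty (hconn := hconn) U x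
    obtain ⟨b, hb⟩ := coneOffProj_nonempty (hconn := hconn) U x'
    refine (setDist_le_dist ha hb).trans (h.dist_le_of_le U ?_)
    by_contra! hlt
    refine hUT (Finset.mem_map.2 ⟨⟨U, hU⟩, (hT ⟨U, hU⟩).2 ⟨_, ha, _, hb, hlt.le⟩, rfl⟩)

theorem uniqueness (h : ConeOffGeometry hΓ ℋ hconn δ D C K M ξ δ' R) {κ : ℝ} (hκ : 0 ≤ κ)
    {x y : VertexSpace Γ hΓ}
    (hxy : κ * (2 * (κ + 2 * (4 * δ + D) + 2) + δ) / 2 + 1 ≤ dist x y) :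
    ∃ U, κ ≤ setDist (coneOffProj hΓ ℋ hconn U x) (coneOffProj hΓ ℋ hconn U y) := by
  have hD := h.D_nonneg
  have hδ := h.δ_nonneg
  by_contra! hcon
  obtain ⟨n, f, hd, f0, fn, hf, hstep⟩ := exists_conePath (ℋ := ℋ) (hconn := hconn) x y
  -- The index `Γ` bounds the number of cone-off steps by `κ`. Taking `κ + 2 * (4 * δ + D)` for the
  -- separation below then yields a member whose projections are more than `κ` apart.
  have hn : (n : ℝ) < κ := by
    have := hcon (topIndex ℋ)
    rwa [setDist_coneOffProj_topIndex, hd] at this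
  obtain ⟨U, hU⟩ := exists_far_projections (R := κ + 2 * (4 * δ + D)) (D := D)
    (A := fun U : {U : ↥(insert ⊤ ℋ : Set Γ.Subgraph) // U ≠ topIndex ℋ} => pts Γ hΓ U.1.1)
    (f := fun k => coneIncl hΓ ℋ hconn _ (f k)) (VertexSpace.isDiscretelyGeodesic Γ hΓ)
    h.fourPoint h.δ_nonneg (by positivity) (fun U => h.quasiConvex U.1) rfl hstep (by
      simp only [f0, fn, coneIncl_toTop]
      have : n * (2 * (κ + 2 * (4 * δ + D) + 2) + δ) ≤
        κ * (2 * (κ + 2 * (4 * δ + D) + 2) + δ) := by gcongr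
      linarith)
  simp only [f0, fn, coneIncl_toTop] at hU
  obtain ⟨a, ha, b, hb, hab⟩ := exists_dist_lt_of_setDist_lt
    (coneOffProj_nonempty U.1 x) (coneOffProj_nonempty U.1 y) (hcon U.1)
  have h1 : _ < dist (coneIncl hΓ ℋ hconn _ a) (coneIncl hΓ ℋ hconn _ b) := hU _ ha _ hb
  have h2 := h.le_dist U.1 U.2 a b
  linarith

end ConeOffGeometry

end HHS
theorem DiamLE.mono {M : Type u} [MetricSpace M] {S : Set M} {r r' : ℝ} (h : DiamLE S r)
    (hr : r ≤ r') : DiamLE S r' := fun x hx y hy => (h x hx y hy).trans hr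

theorem IsHyperbolicSpace.mono {M : Type u} [MetricSpace M] {δ δ' : ℝ}
    (h : IsHyperbolicSpace δ M) (hδ : δ ≤ δ') : IsHyperbolicSpace δ' M :=
  ⟨h.exists_geodesic, fun x y z α β γ hα hβ hγ p hp => by
    obtain ⟨q, hq, hd⟩ := h.slim x y z α β γ hα hβ hγ p hp
    exact ⟨q, hq, hd.trans hδ⟩⟩

/-! ### Assembly of the structure, the factor system and the constants. -/

section HHS

variable {V : Type u} {Γ : SimpleGraph V} {hΓ : Γ.Connected} {ℋ : Set Γ.Subgraph}
  {hconn : ∀ H ∈ ℋ, H.Connected}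

namespace ConeOffGeometry

variable {δ D C K M ξ δ' : ℝ} {R : ℝ → ℝ}

theorem eq_of_nest (h : ConeOffGeometry hΓ ℋ hconn δ D C K M ξ δ' R)
    {U W : ↥(insert ⊤ ℋ : Set Γ.Subgraph)} (hUW : U.1 ≤ W.1) (hW : W ≠ topIndex ℋ) : U = W :=
  by_contra fun hne => hW (h.eq_topIndex U W hUW hne)

theorem ne_topIndex_of_not_le {U W : ↥(insert ⊤ ℋ : Set Γ.Subgraph)} (hUW : ¬ U.1 ≤ W.1) :
    W ≠ topIndex ℋ := by
  rintro rfl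
  exact hUW le_top

theorem finite_complexity (h : ConeOffGeometry hΓ ℋ hconn δ D C K M ξ δ' R)
    (s : Set ↥(insert ⊤ ℋ : Set Γ.Subgraph)) (hs : ∀ U ∈ s, ∀ W ∈ s, U.1 ≤ W.1 ∨ W.1 ≤ U.1) :
    s.encard ≤ 2 := by
  by_cases hex : ∃ U ∈ s, U ≠ topIndex ℋ
  · obtain ⟨U, hU, hne⟩ := hex
    have : s ⊆ {U, topIndex ℋ} := by
      intro W hW
      by_cases hWt : W = topIndex ℋ
      · exact Or.inr hWt
      · obtain hle | hle := hs U hU W hW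
        · exact Or.inl (h.eq_of_nest hle hWt).symm
        · exact Or.inl (h.eq_of_nest hle hne)
    refine (Set.encard_le_encard this).trans ((Set.encard_insert_le _ _).trans ?_)
    rw [Set.encard_singleton]
    norm_num
  · push Not at hex
    have : s ⊆ {topIndex ℋ} := fun W hW => hex W hW
    refine (Set.encard_le_encard this).trans ?_
    rw [Set.encard_singleton]
    norm_num

/-- Pairwise orthogonal families have at most one element `U`, and the point `p U` of `Γ` realises
itself exactly. -/
theorem partial_realization (s : Set ↥(insert ⊤ ℋ : Set Γ.Subgraph))
    (p : ∀ U, ConeOffSpace hΓ ℋ hconn U) (hs : s.Pairwise fun _ _ => False) :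
    ∃ x, ∀ U ∈ s, setDist (coneOffProj hΓ ℋ hconn U x) {p U} ≤ 0 ∧
      ∀ W, setDist (coneOffProj hΓ ℋ hconn W x) (coneRho hΓ ℋ hconn U W) ≤ 0 := by
  rcases s.eq_empty_or_nonempty with rfl | ⟨U, hU⟩
  · exact ⟨coneIncl hΓ ℋ hconn _ (p (topIndex ℋ)), by simp⟩
  · refine ⟨coneIncl hΓ ℋ hconn _ (p U), fun U' hU' => ?_⟩
    obtain rfl : U' = U := by_contra fun hne => hs hU' hU hne
    refine ⟨setDist_le_zero (a := p U') ?_ rfl, fun W => ?_⟩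
    · exact mem_closestPts_self (coneIncl_mem U' (p U'))
    · obtain ⟨a, ha⟩ := coneOffProj_nonempty (hconn := hconn) W
        (coneIncl hΓ ℋ hconn _ (p U'))
      exact setDist_le_zero ha (coneOffProj_subset_coneRho (coneIncl_mem U' (p U')) ha)

/-- The hierarchically hyperbolic structure given by cone-offs and closest point projections. -/
noncomputable def hhStructure (h : ConeOffGeometry hΓ ℋ hconn δ D C K M ξ δ' R) :
    HHStructure (VertexSpace Γ hΓ) ↥(insert ⊤ ℋ : Set Γ.Subgraph) (ConeOffSpace hΓ ℋ hconn) where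
  nest U W := U.1 ≤ W.1
  orth _ _ := False
  proj := coneOffProj hΓ ℋ hconn
  rhoSet := coneRho hΓ ℋ hconn
  rhoMap W U p := coneOffProj hΓ ℋ hconn U (coneIncl hΓ ℋ hconn W p)
  q := 2
  δ := δ'
  ξ := K * (C + ξ) + K
  K := K * (C + 1)
  κ₀ := K * (3 * C + δ) + K
  lam := 2 * C + 2 * δ + M + 1
  -- A sum of the bounds needed for diameters, consistency, geodesic images and large links; the
  -- final `1` gives the strict inequality in large links.
  E := K * (C + ξ) + K + (K * (3 * C + δ) + K) + (2 * C + 2 * δ + M) +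
    (K * (C + (2 * (R (2 * (4 * δ + D)) + 2 * (4 * δ + D) + 2) + δ)) + K) + 1
  α := 0
  complexity := 2
  θ κ := κ * (2 * (κ + 2 * (4 * δ + D) + 2) + δ) / 2 + 1
  quasigeodesic := (VertexSpace.isDiscretelyGeodesic Γ hΓ).isQuasigeodesicSpace
  δ_nonneg := h.δ'_nonneg
  hyperbolic := h.hyperbolic
  ξ_nonneg := by
    have := h.C_nonneg
    have := h.one_le_K
    have := h.ξ_nonneg
    positivity
  proj_nonempty := coneOffProj_nonempty
  proj_diam W x := (h.proj_diam W x).mono (by nlinarith [h.one_le_K, h.ξ_nonneg])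
  proj_lipschitz := h.proj_lipschitz
  nest_refl _ := le_rfl
  nest_trans _ _ _ := le_trans
  nest_antisymm _ _ h₁ h₂ := Subtype.ext (le_antisymm h₁ h₂)
  nest_max := Or.inr ⟨topIndex ℋ, fun W hW => Subtype.ext (top_le_iff.1 hW), fun S hS =>
    (hS (topIndex ℋ) le_top).symm⟩
  rhoSet_nest U W hUW hne := by
    obtain rfl := h.eq_topIndex U W hUW hne
    refine ⟨coneRho_nonempty _ _, (rho_diam_topIndex hne).mono ?_⟩
    nlinarith [h.one_le_K, h.ξ_nonneg, h.C_nonneg]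
  rhoMap_nonempty _ _ _ _ _ := coneOffProj_nonempty _ _
  orth_symm _ _ := id
  orth_irrefl _ := id
  orth_of_nest _ _ _ _ := id
  orth_container _ _ _ := fun ⟨_, _, hf⟩ => hf.elim
  orth_not_nest _ _ := False.elim
  κ₀_nonneg := by
    have := h.C_nonneg
    have := h.one_le_K
    have := h.δ_nonneg
    positivity
  rhoSet_transverse U W _ h₁ h₂ := by
    refine ⟨coneRho_nonempty _ _, (h.rho_diam (ne_topIndex_of_not_le h₂)
      (ne_topIndex_of_not_le h₁) fun he => h₁ (he ▸ le_rfl)).mono ?_⟩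
    nlinarith [h.one_le_K, h.C_nonneg]
  consistency_transverse U W _ _ _ x := h.consistency U W x
  consistency_nest U W hUW hne x := by
    obtain rfl := h.eq_topIndex U W hUW hne
    refine Or.inr ((h.consistency_topIndex U x).mono ?_)
    nlinarith [h.one_le_K, h.C_nonneg, h.δ_nonneg,
      mul_nonneg (zero_le_one.trans h.one_le_K) h.C_nonneg,
      mul_nonneg (zero_le_one.trans h.one_le_K) h.δ_nonneg]
  rho_consistency U U' W hUU' hW := by
    -- Either alternative in `hW` excludes `Γ`, so nesting of `U` in `U'` forces equality and the
    -- two sets `ρ` coincide.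
    have hU' : U' ≠ topIndex ℋ := by
      rintro rfl
      obtain ⟨hle, hne⟩ | ⟨⟨-, -, hn⟩, -⟩ := hW
      · exact hne (Subtype.ext (top_le_iff.1 hle).symm)
      · exact hn le_top
    obtain rfl := h.eq_of_nest hUU' hU'
    obtain ⟨a, ha⟩ := coneRho_nonempty (hΓ := hΓ) (hconn := hconn) U W
    refine (setDist_le_zero ha ha).trans ?_
    have := h.C_nonneg
    have := h.one_le_K
    have := h.δ_nonneg
    positivity
  finite_complexity := h.finite_complexity
  one_le_lam := by linarith [h.C_nonneg, h.δ_nonneg, h.M_nonneg]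
  max_le_E := by
    have := h.C_nonneg
    have := h.one_le_K
    have := h.δ_nonneg
    have := h.M_nonneg
    have := h.ξ_nonneg
    have := h.D_nonneg
    have := h.R_nonneg (2 * (4 * δ + D))
    have h1 : 0 ≤ K * (C + ξ) + K := by positivity
    have h2 : 0 ≤ K * (3 * C + δ) + K := by positivity
    have h3 : 0 ≤ K * (C + (2 * (R (2 * (4 * δ + D)) + 2 * (4 * δ + D) + 2) + δ)) + K := by
      positivity
    exact max_le (by linarith) (by linarith)
  large_links W x x' := by
    by_cases hW : W = topIndex ℋ
    · subst hW
      obtain ⟨T, hT, hT', hT''⟩ := h.large_links rfl x x'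
      rw [setDist_coneOffProj_topIndex]
      have hd : 0 ≤ dist (toTop hΓ ℋ hconn x) (toTop hΓ ℋ hconn x') := dist_nonneg
      have hm : 0 ≤ (2 * C + 2 * δ + M) * dist (toTop hΓ ℋ hconn x) (toTop hΓ ℋ hconn x') :=
        mul_nonneg (by linarith [h.C_nonneg, h.δ_nonneg, h.M_nonneg]) hd
      refine ⟨T, Nat.le_floor ?_, fun U hU => ⟨le_top, (hT' U hU).1, ?_⟩, fun U _ hne => ?_⟩
      · linarith [h.C_nonneg, h.δ_nonneg, h.M_nonneg]
      · linarith [(hT' U hU).2]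
      · by_cases hU : U ∈ T
        · exact Or.inl ⟨U, hU, le_rfl⟩
        · refine Or.inr ((hT'' U hne hU).trans_lt ?_)
          have := h.C_nonneg
          have := h.one_le_K
          have := h.δ_nonneg
          have := h.ξ_nonneg
          have h1 : 0 ≤ K * (C + ξ) + K := by positivity
          have h2 : 0 ≤ K * (3 * C + δ) + K := by positivity
          linarith [h.M_nonneg]
    · exact ⟨∅, by simp, by simp, fun U hU hne => absurd (h.eq_of_nest hU hW) hne⟩
  bounded_geodesic_image U W hUW hne a b γ hγ := by
    obtain rfl := h.eq_topIndex U W hUW hne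
    have := h.C_nonneg
    have := h.one_le_K
    have := h.δ_nonneg
    have := h.M_nonneg
    have := h.ξ_nonneg
    have := h.D_nonneg
    have := h.R_nonneg (2 * (4 * δ + D))
    have h1 : 0 ≤ K * (C + ξ) + K := by positivity
    have h2 : K * (C + δ) + K ≤ K * (3 * C + δ) + K := by gcongr; linarith
    have h3 : 0 ≤ K * (C + (2 * (R (2 * (4 * δ + D)) + 2 * (4 * δ + D) + 2) + δ)) + K := by
      positivity
    have h4 : 0 ≤ K * (C + δ) + K := by positivity
    exact h.bounded_geodesic_image U hγ (by linarith) (by linarith)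
  partial_realization s p hs _ := by
    obtain ⟨x, hx⟩ := partial_realization s p hs
    exact ⟨x, fun U hU => ⟨(hx U hU).1, fun W _ _ => (hx U hU).2 W,
      fun W _ _ _ => (hx U hU).2 W⟩⟩
  uniqueness _ hκ _ _ hxy := h.uniqueness hκ hxy

theorem isFactorSystem (h : ConeOffGeometry hΓ ℋ hconn δ D C K M ξ δ' R)
    (hqi : ∃ K : ℝ, 1 ≤ K ∧ ∀ H (hH : H ∈ ℋ), IsQIEmbedding K (incl Γ hΓ H (hconn H hH)))
    (hinf : ∀ H ∈ ℋ, ¬ ∃ R : ℝ, DiamLE (pts Γ hΓ H) R)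
    (hdiam : ∀ H₁ ∈ ℋ, ∀ H₂ ∈ ℋ, H₁ ≠ H₂ → DiamLE (projSet (pts Γ hΓ H₁) (pts Γ hΓ H₂)) ξ)
    (hsep : ∀ ε : ℝ, ∃ R : ℝ, ∀ H₁ ∈ ℋ, ∀ H₂ ∈ ℋ, H₁ ≠ H₂ →
      DiamLE (nbhd ε (pts Γ hΓ H₁) ∩ pts Γ hΓ H₂) R)
    (hanti : ∀ H₁ ∈ ℋ, ∀ H₂ ∈ ℋ, H₁ ≤ H₂ → H₁ = H₂) : IsFactorSystem Γ hΓ ℋ := by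
  obtain ⟨K', hK', hqi⟩ := hqi
  -- `B = 0` suffices because a member projects onto itself exactly, and `c = 1` because `ℋ` is an
  -- antichain.
  refine ⟨hconn, K', ξ, 0, 1, hK', h.ξ_nonneg, le_rfl, hqi, ?_, ?_, ?_, ?_⟩
  · intro H₁ h₁ H₂ h₂
    by_cases he : H₁ = H₂
    · subst he
      refine Or.inr ⟨H₁, h₁, le_rfl, ?_⟩
      have : projSet (pts Γ hΓ H₁) (pts Γ hΓ H₁) = pts Γ hΓ H₁ := by
        ext y
        simp only [projSet, Set.mem_iUnion₂]
        exact ⟨fun ⟨x, _, hy⟩ => hy.1, fun hy => ⟨y, hy, mem_closestPts_self hy⟩⟩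
      rw [this, Metric.hausdorffEDist_self]
      exact bot_le
    · exact Or.inl (hdiam H₁ h₁ H₂ h₂ he)
  · intro H₁ h₁ H₂ h₂ hd
    by_contra hle
    -- Points of `H₁` are within `1` of a projection of diameter at most `ξ`, which would bound the
    -- diameter of `H₁`.
    refine hinf H₁ h₁ ⟨ξ + 2, fun x hx y hy => ?_⟩
    have hlt : Metric.hausdorffEDist (pts Γ hΓ H₁) (projSet (pts Γ hΓ H₁) (pts Γ hΓ H₂)) < 1 := by
      rw [Metric.hausdorffEDist_comm]
      exact hd.trans_lt (by simp)
    obtain ⟨a, ha, hxa⟩ := Metric.exists_edist_lt_of_hausdorffEDist_lt hx hlt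
    obtain ⟨b, hb, hyb⟩ := Metric.exists_edist_lt_of_hausdorffEDist_lt hy hlt
    rw [edist_dist, ENNReal.ofReal_lt_one] at hxa hyb
    have h1 := hdiam H₁ h₁ H₂ h₂ (fun he => hle he.le) a ha b hb
    have h2 := dist_triangle4 x a b y
    rw [dist_comm b y] at h2
    linarith
  · intro n f hf hmono
    by_contra! hn
    have hlt : f ⟨0, by omega⟩ < f ⟨1, hn⟩ := hmono (by simp)
    exact hlt.ne (hanti _ (hf _) _ (hf _) hlt.le)
  · intro H₁ h₁ H₂ h₂ hd
    by_contra hne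
    obtain ⟨r, hr⟩ := ENNReal.lt_iff_exists_nnreal_btwn.1 hd
    obtain ⟨R', hR'⟩ := hsep r
    -- At finite Hausdorff distance, all of `H₁` lies in a neighbourhood of `H₂`, so separation
    -- would bound its diameter.
    refine hinf H₁ h₁ ⟨R', fun x hx y hy => ?_⟩
    have key : ∀ x ∈ pts Γ hΓ H₁, x ∈ nbhd r (pts Γ hΓ H₂) ∩ pts Γ hΓ H₁ := by
      intro x hx
      obtain ⟨a, ha, hxa⟩ := Metric.exists_edist_lt_of_hausdorffEDist_lt hx hr.1
      rw [edist_nndist, ENNReal.coe_lt_coe] at hxa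
      exact ⟨⟨a, ha, by exact_mod_cast hxa.le⟩, hx⟩
    exact hR' H₂ h₂ H₁ h₁ (Ne.symm hne) x (key x hx) y (key y hy)

end ConeOffGeometry

theorem exists_coneOffGeometry
    (hyp : ∃ δ : ℝ, IsHyperbolicSpace δ (VertexSpace Γ hΓ))
    (hqi : ∃ K : ℝ, 1 ≤ K ∧ ∀ H (hH : H ∈ ℋ), IsQIEmbedding K (incl Γ hΓ H (hconn H hH)))
    (hsep : ∀ ε : ℝ, ∃ R : ℝ, ∀ H₁ ∈ ℋ, ∀ H₂ ∈ ℋ, H₁ ≠ H₂ →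
      DiamLE (nbhd ε (pts Γ hΓ H₁) ∩ pts Γ hΓ H₂) R)
    (hanti : ∀ H₁ ∈ ℋ, ∀ H₂ ∈ ℋ, H₁ ≤ H₂ → H₁ = H₂) :
    ∃ (δ D C K M ξ δ' : ℝ) (R : ℝ → ℝ), ConeOffGeometry hΓ ℋ hconn δ D C K M ξ δ' R ∧
      ∀ H₁ ∈ ℋ, ∀ H₂ ∈ ℋ, H₁ ≠ H₂ → DiamLE (projSet (pts Γ hΓ H₁) (pts Γ hΓ H₂)) ξ := by
  obtain ⟨δ₀, hδ₀⟩ := hyp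
  obtain ⟨K, hK, hqi⟩ := hqi
  choose R hR using hsep
  have hX := VertexSpace.isDiscretelyGeodesic Γ hΓ
  -- The lower bound `1` lets the same constant control intervals between points at distance at most
  -- `1`.
  set e : ℝ := max δ₀ 1 with he
  have he1 : 1 ≤ e := le_max_right _ _
  have hs : SlimIntervals e (VertexSpace Γ hΓ) := fun x y z w hw => by
    obtain ⟨v, hv, hd⟩ := hδ₀.slimIntervals hX x y z w hw
    exact ⟨v, hv, hd.trans (le_max_left _ _)⟩
  have h4 := hs.fourPoint hX (by linarith)
  have hmin : ∀ W : ↥(insert ⊤ ℋ : Set Γ.Subgraph), W ≠ topIndex ℋ → ∀ H' ∈ ℋ, ¬ H' < W.1 :=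
    fun W hW H' hH' hlt => hlt.ne (hanti _ hH' _ (mem_of_ne_topIndex hW) hlt.le)
  have hle : ∀ W : ↥(insert ⊤ ℋ : Set Γ.Subgraph), W ≠ topIndex ℋ →
      ∀ a b : ConeOffSpace hΓ ℋ hconn W,
        dist (coneIncl hΓ ℋ hconn W a) (coneIncl hΓ ℋ hconn W b) ≤ dist a b :=
    fun W hW => dist_coneIncl_le (mem_of_ne_topIndex hW) (hmin W hW)
  have hK2 : ∀ W : ↥(insert ⊤ ℋ : Set Γ.Subgraph), W ≠ topIndex ℋ →
      ∀ a b : ConeOffSpace hΓ ℋ hconn W, dist a b ≤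
        K ^ 2 * dist (coneIncl hΓ ℋ hconn W a) (coneIncl hΓ ℋ hconn W b) + K ^ 2 :=
    fun W hW => dist_le_of_isQIEmbedding (mem_of_ne_topIndex hW) (hmin W hW) hK
      (hqi _ (mem_of_ne_topIndex hW))
  obtain ⟨D, δ₁, hD, hδ₁, hDδ⟩ := exists_quasiConvex_hyperbolic he1 (sq_nonneg K) hs hle hK2
  obtain ⟨M, δ₂, hM, hδ₂, hhyp, hst⟩ := exists_cone_stability (hconn := hconn)
    (zero_le_one.trans he1) hD hs (fun W hW => (hDδ W hW).1)
  have hQ : ∀ W : ↥(insert ⊤ ℋ : Set Γ.Subgraph), QuasiConvex D (pts Γ hΓ W.1) := by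
    intro W
    by_cases hW : W = topIndex ℋ
    · subst hW
      exact fun _ _ _ _ z _ => ⟨z, trivial, by rwa [dist_self]⟩
    · exact (hDδ W hW).1
  have hδ : 0 ≤ 4 * e + 2 := by linarith
  have hE : ∀ W : ↥(insert ⊤ ℋ : Set Γ.Subgraph),
      EfficientProj (2 * D + 2 * (4 * e + 2) + 1) (pts Γ hΓ W.1) :=
    fun W => (hQ W).efficientProj h4 hδ hD hX
  set C := 2 * D + 2 * (4 * e + 2) + 1 with hC
  have hC0 : 0 ≤ C := by positivity
  set ε := 2 * C + 2 * (4 * e + 2) + D with hε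
  -- Two projected points further apart than the contraction threshold are both `ε`-close to `H₂`,
  -- so they lie in a coarse intersection of diameter at most `R ε`.
  have hdiam : ∀ H₁ ∈ ℋ, ∀ H₂ ∈ ℋ, H₁ ≠ H₂ →
      DiamLE (projSet (pts Γ hΓ H₁) (pts Γ hΓ H₂)) (max (C + (4 * e + 2)) (R ε)) := by
    intro H₁ h₁ H₂ h₂ hne y hy y' hy'
    simp only [projSet, Set.mem_iUnion₂] at hy hy'
    obtain ⟨x, hx, hy⟩ := hy
    obtain ⟨x', hx', hy'⟩ := hy'
    rcases le_or_gt (dist y y') (C + (4 * e + 2)) with h | h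
    · exact h.trans (le_max_left _ _)
    · refine le_trans ?_ (le_max_right _ _)
      have hE₁ := hE ⟨H₁, Or.inr h₁⟩
      have hQ₂ := hQ ⟨H₂, Or.inr h₂⟩
      exact hR ε H₂ h₂ H₁ h₁ (Ne.symm hne) _
        ⟨hE₁.exists_near_of_far h4 hδ hX hQ₂ hx hx' hy hy' h, hy.1⟩ _
        ⟨hE₁.exists_near_of_far h4 hδ hX hQ₂ hx' hx hy' hy (by rwa [dist_comm]), hy'.1⟩
  refine ⟨4 * e + 2, D, C, K ^ 2, M, max (C + (4 * e + 2)) (R ε), max δ₁ δ₂,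
    fun r => max (R r) 0, ?_, hdiam⟩
  exact {
    δ_nonneg := hδ
    D_nonneg := hD
    C_nonneg := hC0
    one_le_K := one_le_pow₀ hK
    M_nonneg := hM
    ξ_nonneg := (by positivity : 0 ≤ C + (4 * e + 2)).trans (le_max_left _ _)
    δ'_nonneg := hδ₁.trans (le_max_left _ _)
    R_nonneg := fun r => le_max_right _ _
    fourPoint := h4
    quasiConvex := hQ
    efficientProj := hE
    dist_le := fun W a b => by
      by_cases hW : W = topIndex ℋ
      · subst hW
        have h1 := dist_toTop_le (ℋ := ℋ) (hconn := hconn) (coneIncl hΓ ℋ hconn _ a)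
          (coneIncl hΓ ℋ hconn _ b)
        rw [toTop_coneIncl, toTop_coneIncl] at h1
        have h2 : 0 ≤ dist (coneIncl hΓ ℋ hconn _ a) (coneIncl hΓ ℋ hconn _ b) := dist_nonneg
        nlinarith [one_le_pow₀ hK (n := 2)]
      · exact hK2 W hW a b
    le_dist := hle
    diam_proj := fun U W hU hW hne => hdiam _ (mem_of_ne_topIndex hW) _ (mem_of_ne_topIndex hU)
      fun h => hne (Subtype.ext h.symm)
    separated := fun r U W hU hW hne => (hR r _ (mem_of_ne_topIndex hU) _
      (mem_of_ne_topIndex hW) fun h => hne (Subtype.ext h)).mono (le_max_left _ _)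
    stability := hst
    hyperbolic := fun W => by
      by_cases hW : W = topIndex ℋ
      · subst hW
        exact hhyp.mono (le_max_right _ _)
      · exact (hDδ W hW).2.mono (le_max_left _ _)
    eq_topIndex := fun U W hUW hne => by
      by_contra hW
      refine hne (Subtype.ext (hanti _ (mem_of_ne_topIndex ?_) _ (mem_of_ne_topIndex hW) hUW))
      rintro rfl
      exact hW (Subtype.ext (top_le_iff.1 hUW)) }

end HHS

end HHGraph

theorem mainTheorem4 {V : Type u} (Γ : SimpleGraph V) (hΓ : Γ.Connected)
    (hyp : ∃ δ : ℝ, HHGraph.IsHyperbolicSpace δ (HHGraph.VertexSpace Γ hΓ))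
    (ℋ : Set Γ.Subgraph) (hconn : ∀ H ∈ ℋ, H.Connected)
    (hqi : ∃ K : ℝ, 1 ≤ K ∧ ∀ H (hH : H ∈ ℋ),
      HHGraph.IsQIEmbedding K (HHGraph.incl Γ hΓ H (hconn H hH)))
    (hinf : ∀ H ∈ ℋ, ¬ ∃ R : ℝ, HHGraph.DiamLE (HHGraph.pts Γ hΓ H) R)
    (hsep : ∀ ε : ℝ, ∃ R : ℝ, ∀ H₁ ∈ ℋ, ∀ H₂ ∈ ℋ, H₁ ≠ H₂ →
      HHGraph.DiamLE (HHGraph.nbhd ε (HHGraph.pts Γ hΓ H₁) ∩ HHGraph.pts Γ hΓ H₂) R) :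
    HHGraph.IsFactorSystem Γ hΓ ℋ ∧
      ∃ S : HHGraph.HHStructure (HHGraph.VertexSpace Γ hΓ) ↥(insert ⊤ ℋ : Set Γ.Subgraph)
          (HHGraph.ConeOffSpace hΓ ℋ hconn),
        (∀ U W, S.nest U W ↔ U.1 ≤ W.1) ∧ (∀ U W, ¬ S.orth U W) ∧
          ∀ W x, S.proj W x = HHGraph.coneOffProj hΓ ℋ hconn W x := by
  have hanti : ∀ H₁ ∈ ℋ, ∀ H₂ ∈ ℋ, H₁ ≤ H₂ → H₁ = H₂ := by
    intro H₁ h₁ H₂ h₂ hle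
    by_contra hne
    -- If `H₁` were properly contained in `H₂`, the intersection at scale `0` would be all of `H₁`,
    -- which has infinite diameter.
    obtain ⟨R, hR⟩ := hsep 0
    have hsub : ∀ x ∈ HHGraph.pts Γ hΓ H₁,
        x ∈ HHGraph.nbhd 0 (HHGraph.pts Γ hΓ H₂) ∩ HHGraph.pts Γ hΓ H₁ :=
      fun x hx => ⟨⟨x, hle.1 hx, (dist_self x).le⟩, hx⟩
    exact hinf H₁ h₁ ⟨R, fun x hx y hy =>
      hR H₂ h₂ H₁ h₁ (Ne.symm hne) x (hsub x hx) y (hsub y hy)⟩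
  obtain ⟨δ, D, C, K, M, ξ, δ', R, h, hdiam⟩ :=
    HHGraph.exists_coneOffGeometry hyp hqi hsep hanti
  exact ⟨h.isFactorSystem hqi hinf hdiam hsep hanti, h.hhStructure, fun _ _ => Iff.rfl,
    fun _ _ => id, fun _ _ => rfl⟩
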